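/- Consider the one-dimensional radiation hydrodynamical equations (zero diffusion limit) $$\partial_t U+\partial_x F(U)=0,\qquad U=(\rho,\rho u,E)^T,\quad F(U)=(\rho u,\ \rho u^2+p_{tot},\ u(E+p_{tot}))^T,$$ with $p=(\gamma-1)\rho e$, $e=C_vT$, $p_{tot}=p+\frac13\hat a_RT^4$, $e_{tot}=e+\hat a_R\rho^{-1}T^4$, $E=\frac12\rho u^2+\rho e_{tot}$, where $\gamma>1$, $\hat a_R\ge 0$, $C_v>0$ are constants and $\rho,e>0$. Put $\hat K=p+\frac{4\hat a_Re^4}{3C_v^4}$, $\tilde K=\rho+\frac{4\hat a_Re^3}{C_v^4}$, and let $c=\sqrt{\frac p\rho+\frac{\hat K^2}{\rho e\tilde K}}$ be the speed of sound. For $\rho,p_{tot}>0$ regard $e$ (the positive root), $T$ and $e_{tot}$ as functions of $(\rho,p_{tot})$. Then $$\frac{\partial e_{tot}}{\partial\rho}=\frac{3(1-\gamma)\rho^2e^2-15(\gamma-1)\rho e\,\hat a_RT^4-4\hat a_R^2T^8}{3\rho^2\hat K},\qquad \frac{\partial e_{tot}}{\partial p_{tot}}=\frac{e\tilde K}{\rho\hat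 K}.$$ For $p_{tot},\bar p_{tot},\bar\rho>0$ the Hugoniot relation $e_{tot}(\bar\rho,\bar p_{tot})-e_{tot}(\rho,p_{tot})=\frac12(\bar p_{tot}+p_{tot})\frac{\bar\rho-\rho}{\bar\rho\rho}$ has exactly one solution $\rho=H(p_{tot},\bar p_{tot},\bar\rho)>0$, and at this $\rho$, with $N=\frac{\partial e_{tot}}{\partial\rho}(\rho,p_{tot})-\frac{p_{tot}+\bar p_{tot}}{2\rho^2}$, $$H_1:=\frac{\partial H}{\partial p_{tot}}=-\frac1N\Big(\frac{\partial e_{tot}}{\partial p_{tot}}(\rho,p_{tot})-\frac{\rho-\bar\rho}{2\rho\bar\rho}\Big),\quad H_2:=\frac{\partial H}{\partial\bar p_{tot}}=\frac1N\Big(\frac{\partial e_{tot}}{\partial p_{tot}}(\bar\rho,\bar p_{tot})+\frac{\rho-\bar\rho}{2\rho\bar\rho}\Big),\quad H_3:=\frac{\partial H}{\partial\bar\rho}=\frac1N\Big(\frac{\partial e_{tot}}{\partial\rho}(\bar\rho,\bar p_{tot})-\frac{p_{tot}+\bar p_{tot}}{2\bar\rho^2}\Big).$$ The function $\Phi(p_{tot},\bar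 p_{tot},\bar\rho,\rho)=\sqrt{(p_{tot}-\bar p_{tot})\left(\frac1{\bar\rho}-\frac1\rho\right)}$ has, where $\bar\rho,\rho>0$ and the radicand is positive, the partial derivatives $$\frac{\partial\Phi}{\partial p_{tot}}=\frac1{2\Phi}\Big(\frac1{\bar\rho}-\frac1\rho\Big),\quad \frac{\partial\Phi}{\partial\bar p_{tot}}=\frac1{2\Phi}\Big(\frac1\rho-\frac1{\bar\rho}\Big),\quad \frac{\partial\Phi}{\partial\bar\rho}=\frac{\bar p_{tot}-p_{tot}}{2\Phi\bar\rho^2},\quad \frac{\partial\Phi}{\partial\rho}=\frac{p_{tot}-\bar p_{tot}}{2\Phi\rho^2}.$$ Put $\Phi_1=\frac{\partial\Phi}{\partial p_{tot}}+\frac{\partial\Phi}{\partial\rho}H_1$, $\Phi_2=\frac{\partial\Phi}{\partial\bar p_{tot}}+\frac{\partial\Phi}{\partial\rho}H_2$, $\Phi_3=\frac{\partial\Phi}{\partial\bar\rho}+\frac{\partial\Phi}{\partial\rho}H_3$. Consider, near $(x,t)=(0,0)$, a piecewise smooth solution of the generalized Riemann problem, with initial data $U_R+xU'_R$ for $x>0$,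 which from left to right consists of: a left-going wave, ending at a curve $x=y(t)$; a smooth intermediate flow; a contact discontinuity $x=\xi(t)$; a second smooth intermediate flow; a shock $x=x(t)$; and the smooth flow issued from the right initial data. Here $y(0)=\xi(0)=x(0)=0$ and $y<\xi<x$ for small $t>0$; $y$ is continuous and $\xi$, $x(\cdot)$ are $C^1$ up to $t=0$; the three flows are classical solutions, $C^1$ up to their boundaries; the Rankine--Hugoniot relations hold across the contact discontinuity, which moves with the speed of the fluid, and across the shock. Nothing is assumed about the flow to the left of $y$. Denote by $(\rho_{2*},u_*,p_{tot,*})$ and $c_{2*}$ the limits at the origin of the state between the contact discontinuity and the shock, and by $(\rho_R,u_R,p_{tot,R})$ and $c_R$ those of the state to the right of the shock; the right-going wave is a shock in the sense that $p_{tot,*}>p_{tot,R}$. Let $(p_{tot}')_R,u_R',\rho_R'$ be the $x$-derivatives at $x=0+$ of $p_{tot},u,\rho$ in the initial data, and let $\frac{D}{Dt}=\partial_t+u\partial_x$. Then $\rho_{2*}=H(p_{tot,*},p_{tot,R},\rho_R)$, $u_*=u_R+\Phi(p_{tot,*},p_{tot,R},\rho_R,\rho_{2*})$, the initial shock speed is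 $x'(0)=\sigma_R:=\frac{\rho_{2*}u_*-\rho_Ru_R}{\rho_{2*}-\rho_R}$, the quantities $\frac{Du}{Dt}$ and $\frac{Dp_{tot}}{Dt}$ have limits $\left(\frac{Du}{Dt}\right)_*$ and $\left(\frac{Dp_{tot}}{Dt}\right)_*$ at the origin within the union of the two open intermediate regions (in particular along $x=0$, $t\to0+$, whenever $(0,t)$ lies in that union for all small $t>0$), and $$a_R\left(\frac{Du}{Dt}\right)_*+b_R\left(\frac{Dp_{tot}}{Dt}\right)_*=d_R,$$ where, all $\Phi_i$ being evaluated at $(p_{tot,*},p_{tot,R},\rho_R,\rho_{2*})$, $$a_R=1+\rho_{2*}(\sigma_R-u_*)\Phi_1,\qquad b_R=-\frac{\sigma_R-u_*}{\rho_{2*}c_{2*}^2}-\Phi_1,\qquad d_R=L_{p}(p_{tot}')_R+L_{u}u_R'+L_{\rho}\rho_R',$$ $$L_{p}=-\frac1{\rho_R}+(\sigma_R-u_R)\Phi_2,\qquad L_{u}=\sigma_R-u_R-\rho_Rc_R^2\Phi_2-\rho_R\Phi_3,\qquad L_{\rho}=(\sigma_R-u_R)\Phi_3.$$ -/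

import Mathlib

open Set Filter Topology

namespace RadHydro

noncomputable section

/-- A perfect gas with equilibrium radiation: adiabatic index `γ`, radiation coefficient `rad`,
specific heat at constant volume `Cv`. -/
structure Gas where
  γ : ℝ
  rad : ℝ
  Cv : ℝ
  one_lt_γ : 1 < γ
  rad_nonneg : 0 ≤ rad
  Cv_pos : 0 < Cv

/-- A fluid state: density `ρ`, velocity `u`, specific internal energy `e`. -/
structure State where
  ρ : ℝ
  u : ℝ
  e : ℝ

namespace Gas

variable (G : Gas)

/-! ### Thermodynamics in terms of density and specific internal energy -/

/-- Temperature, from `e = Cv * T`. -/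
def temp (e : ℝ) : ℝ := e / G.Cv

/-- Gas pressure `p = (γ - 1) ρ e`. -/
def pres (ρ e : ℝ) : ℝ := (G.γ - 1) * ρ * e

/-- Total pressure: gas pressure plus radiation pressure. -/
def pTot (ρ e : ℝ) : ℝ := G.pres ρ e + G.rad * G.temp e ^ 4 / 3

/-- Total specific internal energy. -/
def eTot (ρ e : ℝ) : ℝ := e + G.rad * G.temp e ^ 4 / ρ

/-- `K̂ = p + 4 a e⁴ / (3 Cv⁴)`. -/
def Khat (ρ e : ℝ) : ℝ := G.pres ρ e + 4 * G.rad * e ^ 4 / (3 * G.Cv ^ 4)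

/-- `K̃ = ρ + 4 a e³ / Cv⁴`. -/
def Ktilde (ρ e : ℝ) : ℝ := ρ + 4 * G.rad * e ^ 3 / G.Cv ^ 4

/-- Speed of sound. -/
def sound (ρ e : ℝ) : ℝ :=
  Real.sqrt (G.pres ρ e / ρ + G.Khat ρ e ^ 2 / (ρ * e * G.Ktilde ρ e))

/-! ### Thermodynamics in terms of density and total pressure -/

/-- The specific internal energy as a function of density and total pressure: the positive root
`e` of `pTot ρ e = p`. -/
def energyOf (ρ p : ℝ) : ℝ := Classical.epsilon fun e : ℝ => 0 < e ∧ G.pTot ρ e = p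

/-- `e_tot(ρ, p_tot)`. -/
def eTotOf (ρ p : ℝ) : ℝ := G.eTot ρ (G.energyOf ρ p)

/-- The closed form of `∂e_tot/∂ρ (ρ, p_tot)`. -/
def eTotDρ (ρ p : ℝ) : ℝ :=
  let e := G.energyOf ρ p
  let T := G.temp e
  (3 * (1 - G.γ) * ρ ^ 2 * e ^ 2 - 15 * (G.γ - 1) * ρ * e * (G.rad * T ^ 4)
    - 4 * G.rad ^ 2 * T ^ 8) / (3 * ρ ^ 2 * G.Khat ρ e)

/-- The closed form of `∂e_tot/∂p_tot (ρ, p_tot)`. -/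
def eTotDp (ρ p : ℝ) : ℝ :=
  let e := G.energyOf ρ p
  e * G.Ktilde ρ e / (ρ * G.Khat ρ e)

/-! ### The Hugoniot density function `H` and the function `Φ`

In the order of arguments `p pb ρb ρ`, the letters `pb`, `ρb` stand for the total pressure and the
density ahead of the shock, and `p`, `ρ` for those behind it. -/

/-- The Hugoniot relation between the states `(ρ, p)` and `(ρb, pb)`. -/
def Hugoniot (p pb ρb ρ : ℝ) : Prop :=
  G.eTotOf ρb pb - G.eTotOf ρ p = 1 / 2 * (pb + p) * ((ρb - ρ) / (ρb * ρ))

/-- The density behind the shock, defined implicitly by the Hugoniot relation. -/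
def H (p pb ρb : ℝ) : ℝ := Classical.epsilon fun ρ : ℝ => 0 < ρ ∧ G.Hugoniot p pb ρb ρ

/-- The common denominator of `H₁`, `H₂`, `H₃`. -/
def Hden (p pb ρ : ℝ) : ℝ := G.eTotDρ ρ p - (p + pb) / (2 * ρ ^ 2)

def H₁ (p pb ρb ρ : ℝ) : ℝ :=
  -((G.eTotDp ρ p - (ρ - ρb) / (2 * ρ * ρb)) / G.Hden p pb ρ)

def H₂ (p pb ρb ρ : ℝ) : ℝ :=
  (G.eTotDp ρb pb + (ρ - ρb) / (2 * ρ * ρb)) / G.Hden p pb ρ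

def H₃ (p pb ρb ρ : ℝ) : ℝ :=
  (G.eTotDρ ρb pb - (p + pb) / (2 * ρb ^ 2)) / G.Hden p pb ρ

end Gas

def Φ (p pb ρb ρ : ℝ) : ℝ := Real.sqrt ((p - pb) * (1 / ρb - 1 / ρ))

/-- The closed form of `∂Φ/∂p`. -/
def ΦDp (p pb ρb ρ : ℝ) : ℝ := 1 / (2 * Φ p pb ρb ρ) * (1 / ρb - 1 / ρ)

/-- The closed form of `∂Φ/∂pb`. -/
def ΦDpb (p pb ρb ρ : ℝ) : ℝ := 1 / (2 * Φ p pb ρb ρ) * (1 / ρ - 1 / ρb)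

/-- The closed form of `∂Φ/∂ρb`. -/
def ΦDρb (p pb ρb ρ : ℝ) : ℝ := 1 / (2 * Φ p pb ρb ρ * ρb ^ 2) * (pb - p)

/-- The closed form of `∂Φ/∂ρ`. -/
def ΦDρ (p pb ρb ρ : ℝ) : ℝ := 1 / (2 * Φ p pb ρb ρ * ρ ^ 2) * (p - pb)

namespace Gas

variable (G : Gas)

def Φ₁ (p pb ρb ρ : ℝ) : ℝ := ΦDp p pb ρb ρ + ΦDρ p pb ρb ρ * G.H₁ p pb ρb ρ

def Φ₂ (p pb ρb ρ : ℝ) : ℝ := ΦDpb p pb ρb ρ + ΦDρ p pb ρb ρ * G.H₂ p pb ρb ρ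

def Φ₃ (p pb ρb ρ : ℝ) : ℝ := ΦDρb p pb ρb ρ + ΦDρ p pb ρb ρ * G.H₃ p pb ρb ρ

/-! ### Coefficients of the linear relation

`s` is the limiting state behind the shock, `r` the one ahead of it. -/

/-- Total pressure of a state. -/
def pt (s : State) : ℝ := G.pTot s.ρ s.e

/-- Speed of sound of a state. -/
def cs (s : State) : ℝ := G.sound s.ρ s.e

end Gas

/-- The shock speed `σ_R`. -/
def shockSpeed (s r : State) : ℝ := (s.ρ * s.u - r.ρ * r.u) / (s.ρ - r.ρ)

namespace Gas

variable (G : Gas)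

def coeffA (s r : State) : ℝ :=
  1 + s.ρ * (shockSpeed s r - s.u) * G.Φ₁ (G.pt s) (G.pt r) r.ρ s.ρ

def coeffB (s r : State) : ℝ :=
  -((shockSpeed s r - s.u) / (s.ρ * G.cs s ^ 2)) - G.Φ₁ (G.pt s) (G.pt r) r.ρ s.ρ

def coeffLp (s r : State) : ℝ :=
  -(1 / r.ρ) + (shockSpeed s r - r.u) * G.Φ₂ (G.pt s) (G.pt r) r.ρ s.ρ

def coeffLu (s r : State) : ℝ :=
  shockSpeed s r - r.u - r.ρ * G.cs r ^ 2 * G.Φ₂ (G.pt s) (G.pt r) r.ρ s.ρ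
    - r.ρ * G.Φ₃ (G.pt s) (G.pt r) r.ρ s.ρ

def coeffLρ (s r : State) : ℝ :=
  (shockSpeed s r - r.u) * G.Φ₃ (G.pt s) (G.pt r) r.ρ s.ρ

/-- `d_R`, for the slopes `dp`, `du`, `dρ` of total pressure, velocity and density at `x = 0+` of
the right initial data. -/
def coeffD (s r : State) (dp du dρ : ℝ) : ℝ :=
  G.coeffLp s r * dp + G.coeffLu s r * du + G.coeffLρ s r * dρ

/-! ### The equations -/

/-- Total energy per unit volume. -/
def energy (s : State) : ℝ := 1 / 2 * s.ρ * s.u ^ 2 + s.ρ * G.eTot s.ρ s.e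

/-- The conserved vector `(ρ, ρ u, E)`. -/
def cons (s : State) : ℝ × ℝ × ℝ := (s.ρ, s.ρ * s.u, G.energy s)

/-- The flux vector. -/
def flux (s : State) : ℝ × ℝ × ℝ :=
  (s.ρ * s.u, s.ρ * s.u ^ 2 + G.pt s, s.u * (G.energy s + G.pt s))

/-- The Rankine-Hugoniot relations for a jump from `l` to `r` moving with speed `v`. -/
def RankineHugoniot (l r : State) (v : ℝ) : Prop :=
  v • (G.cons l - G.cons r) = G.flux l - G.flux r

end Gas

/-! ### Local solution of the generalized Riemann problem

Points of the plane are pairs `(x, t)`. -/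

/-- The open region between the curves `x = l t` and `x = r t`, for `0 < t < τ`. -/
def wedge (τ : ℝ) (l r : ℝ → ℝ) : Set (ℝ × ℝ) :=
  {z | z.2 ∈ Ioo 0 τ ∧ z.1 ∈ Ioo (l z.2) (r z.2)}

/-- The same region with the two curves and the initial line included. -/
def wedgeBar (τ : ℝ) (l r : ℝ → ℝ) : Set (ℝ × ℝ) :=
  {z | z.2 ∈ Ico 0 τ ∧ z.1 ∈ Icc (l z.2) (r z.2)}

/-- The field `W` is, between the curves `l` and `r`, a classical solution of the conservation laws
that is continuously differentiable up to the boundary, where its one-sided values are those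
of `V`. -/
structure IsSmoothPiece (G : Gas) (τ : ℝ) (l r : ℝ → ℝ) (W V : ℝ × ℝ → State) : Prop where
  eq : ∀ z ∈ wedge τ l r, W z = V z
  smooth_ρ : ContDiffOn ℝ 1 (fun z => (V z).ρ) (wedgeBar τ l r)
  smooth_u : ContDiffOn ℝ 1 (fun z => (V z).u) (wedgeBar τ l r)
  smooth_e : ContDiffOn ℝ 1 (fun z => (V z).e) (wedgeBar τ l r)
  ρ_pos : ∀ z ∈ wedgeBar τ l r, 0 < (V z).ρ
  e_pos : ∀ z ∈ wedgeBar τ l r, 0 < (V z).e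
  conservation : ∀ z ∈ wedge τ l r,
    deriv (fun t => G.cons (V (z.1, t))) z.2 + deriv (fun x => G.flux (V (x, z.2))) z.1 = 0

/-- The part of a local piecewise smooth solution `W` of the generalized Riemann problem that lies
to the right of the left-going wave: the left-going wave ends at `x = y t`, then follow a smooth
intermediate flow (traces `W₁`), a contact discontinuity `x = ξ t`, a second smooth intermediate
flow (traces `W₂`), a right-going shock `x = X t`, and the flow (traces `W₃`) issued from the right
initial data, whose conserved variables are `UR + x UR'`. Nothing is required to the left of
`x = y t`, so the left-going wave may be of any type. -/
structure IsLocalGRPSolution (G : Gas) (UR UR' : ℝ × ℝ × ℝ) (τ δ : ℝ) (y ξ X : ℝ → ℝ)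
    (W W₁ W₂ W₃ : ℝ × ℝ → State) : Prop where
  τ_pos : 0 < τ
  δ_pos : 0 < δ
  y_zero : y 0 = 0
  ξ_zero : ξ 0 = 0
  X_zero : X 0 = 0
  y_cont : ContinuousOn y (Ico 0 τ)
  ξ_smooth : ContDiffOn ℝ 1 ξ (Ico 0 τ)
  X_smooth : ContDiffOn ℝ 1 X (Ico 0 τ)
  y_lt_ξ : ∀ t ∈ Ioo 0 τ, y t < ξ t
  ξ_lt_X : ∀ t ∈ Ioo 0 τ, ξ t < X t
  piece₁ : IsSmoothPiece G τ y ξ W W₁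
  piece₂ : IsSmoothPiece G τ ξ X W W₂
  piece₃ : IsSmoothPiece G τ X (fun _ => δ) W W₃
  initial : ∀ x ∈ Ico 0 δ, G.cons (W₃ (x, 0)) = UR + x • UR'
  /-- The jump at `x = ξ t` satisfies the Rankine-Hugoniot relations -/
  contact_RH : ∀ t ∈ Ico 0 τ,
    G.RankineHugoniot (W₁ (ξ t, t)) (W₂ (ξ t, t)) (derivWithin ξ (Ico 0 τ) t)
  /-- and belongs to the second characteristic field. -/
  contact_speed : ∀ t ∈ Ico 0 τ, derivWithin ξ (Ico 0 τ) t = (W₁ (ξ t, t)).u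
  shock_RH : ∀ t ∈ Ico 0 τ,
    G.RankineHugoniot (W₂ (X t, t)) (W₃ (X t, t)) (derivWithin X (Ico 0 τ) t)
  /-- The right-going wave is a shock: the total pressure rises behind it. -/
  shock_compressive : G.pt (W₃ (0, 0)) < G.pt (W₂ (0, 0))

/-- The material derivative `D/Dt = ∂/∂t + u ∂/∂x` of the quantity `f` in the flow `W`. -/
def matDeriv (W : ℝ × ℝ → State) (f : State → ℝ) (z : ℝ × ℝ) : ℝ :=
  deriv (fun t => f (W (z.1, t))) z.2 + (W z).u * deriv (fun x => f (W (x, z.2))) z.1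

/-- Slope at `x = 0+` of the quantity `f` in the initial data of the flow `V`. -/
def initialSlope (V : ℝ × ℝ → State) (f : State → ℝ) : ℝ :=
  derivWithin (fun x => f (V (x, 0))) (Ici 0) 0

end

end RadHydro

/-! All fields are C¹ up to the origin, so the relation is linear algebra between one-sided first
derivatives there. Along the shock, the Rankine-Hugoniot conditions amount to the Hugoniot relation
together with `(u - ub)² = (p - pb)(1/ρb - 1/ρ)`. Differentiating both at `t = 0` in the direction
`(σ, 1)` expresses the derivative of the velocity jump through `Φ₁`, `Φ₂`, `Φ₃`
(`Gas.shock_velocity_deriv`).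

A derivative along the shock is `D/Dt + (σ - u) ∂ₓ`, and the balance laws (`Gas.primitive_form`)
read `Dρ/Dt = -ρ ∂ₓu`, `ρ Du/Dt = -∂ₓp`, `Dp/Dt = -ρ c² ∂ₓu`. Behind the shock they trade space
derivatives for material ones; ahead of it they trade material derivatives for slopes of the initial
data. This gives `a_R`, `b_R`, `d_R` (`IsFlowJet.linear_relation`).

The contact discontinuity moves with the fluid, and `u` and `p_tot` are continuous across it. Their
derivatives along it are therefore material derivatives, equal on both sides, which is why the
limits exist in the union of the two intermediate regions.

On the thermodynamic side, `p_tot` is strictly increasing in `e`, and the defect in the Hugoniot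
relation is strictly increasing in `ρ` because `∂e_tot/∂ρ < 0`. Both roots are thus unique, and
implicit differentiation (`HasStrictFDerivAt.of_implicit`) yields their partial derivatives. -/

/-- A function determined implicitly by `F z = F u` near `u = (x₀, φ x₀)`, where the partial
derivative of `F` in the real variable is `b ≠ 0`, is strictly differentiable. -/
theorem HasStrictFDerivAt.of_implicit {E : Type*} [NormedAddCommGroup E] [NormedSpace ℝ E]
    [CompleteSpace E] {F : E × ℝ → ℝ} {φ : E → ℝ} {x₀ : E} {A : E →L[ℝ] ℝ} {b : ℝ}
    (hF : HasStrictFDerivAt F (A.coprod (b • ContinuousLinearMap.id ℝ ℝ)) (x₀, φ x₀))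
    (hb : b ≠ 0) (huniq : ∀ᶠ z in 𝓝 (x₀, φ x₀), F z = F (x₀, φ x₀) → z.2 = φ z.1) :
    HasStrictFDerivAt φ (-b⁻¹ • A) x₀ := by
  have hinr : (A.coprod (b • ContinuousLinearMap.id ℝ ℝ)) ∘L .inr ℝ E ℝ =
      ((ContinuousLinearEquiv.unitsEquivAut ℝ (Units.mk0 b hb) : ℝ ≃L[ℝ] ℝ) : ℝ →L[ℝ] ℝ) := by
    ext; simp
  have hinv : ((A.coprod (b • ContinuousLinearMap.id ℝ ℝ)) ∘L .inr ℝ E ℝ).IsInvertible :=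
    ⟨_, hinr.symm⟩
  have hψ := hF.hasStrictFDerivAt_implicitFunctionOfProdDomain hinv
  have htend := hF.tendsto_implicitFunctionOfProdDomain hinv
  -- No continuity of `φ` is assumed: the graph of the implicit function stays near the base point,
  -- where every solution lies on the graph of `φ`.
  have heq : hF.implicitFunctionOfProdDomain hinv =ᶠ[𝓝 x₀] φ := by
    filter_upwards [hF.eventually_apply_implicitFunctionOfProdDomain hinv,
      (tendsto_id.prodMk_nhds htend).eventually huniq] with x hx hx'
    exact hx' hx
  refine (hψ.congr_of_eventuallyEq heq).congr_fderiv ?_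
  rw [hinr, ContinuousLinearMap.inverse_equiv]
  ext v
  simp [mul_comm]

/-! ### Thermodynamics in the variables density and total pressure -/

namespace RadHydro

namespace Gas

variable (G : Gas)

theorem γ_sub_one_pos : 0 < G.γ - 1 := sub_pos.2 G.one_lt_γ

theorem pTot_eq (ρ e : ℝ) :
    G.pTot ρ e = (G.γ - 1) * ρ * e + G.rad / (3 * G.Cv ^ 4) * e ^ 4 := by
  have := G.Cv_pos.ne'
  simp only [pTot, pres, temp]
  field_simp

theorem eTot_eq (ρ e : ℝ) : G.eTot ρ e = e + G.rad / G.Cv ^ 4 * e ^ 4 / ρ := by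
  simp only [eTot, temp, div_pow]
  ring

theorem rad_coeff_nonneg : 0 ≤ G.rad / (3 * G.Cv ^ 4) :=
  div_nonneg G.rad_nonneg (by have := G.Cv_pos; positivity)

theorem pTot_strictMonoOn {ρ : ℝ} (hρ : 0 < ρ) : StrictMonoOn (G.pTot ρ) (Ici 0) := by
  intro e he e' _ h
  have he : 0 ≤ e := he
  have h1 := mul_lt_mul_of_pos_left h (mul_pos G.γ_sub_one_pos hρ)
  have h2 := mul_le_mul_of_nonneg_left (pow_le_pow_left₀ he h.le 4) G.rad_coeff_nonneg
  rw [G.pTot_eq, G.pTot_eq]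
  linarith

theorem pTot_pos {ρ e : ℝ} (hρ : 0 < ρ) (he : 0 < e) : 0 < G.pTot ρ e := by
  have := G.pTot_strictMonoOn hρ self_mem_Ici (mem_Ici.2 he.le) he
  simpa [G.pTot_eq] using this

theorem energyOf_spec {ρ p : ℝ} (hρ : 0 < ρ) (hp : 0 < p) :
    0 < G.energyOf ρ p ∧ G.pTot ρ (G.energyOf ρ p) = p := by
  refine Classical.epsilon_spec (p := fun e : ℝ => 0 < e ∧ G.pTot ρ e = p) ?_
  have hγ := mul_pos G.γ_sub_one_pos hρ
  -- At `e = M` the gas pressure alone equals `p`, so the root lies in `[0, M]`.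
  set M := p / ((G.γ - 1) * ρ) with hM
  have hM0 : 0 < M := div_pos hp hγ
  have hcont : ContinuousOn (G.pTot ρ) (Icc 0 M) := by
    have : G.pTot ρ = fun e => (G.γ - 1) * ρ * e + G.rad / (3 * G.Cv ^ 4) * e ^ 4 :=
      funext (G.pTot_eq ρ)
    rw [this]; fun_prop
  have h0 : G.pTot ρ 0 = 0 := by simp [G.pTot_eq]
  have h1 : p ≤ G.pTot ρ M := by
    rw [G.pTot_eq, hM, mul_div_cancel₀ _ hγ.ne']
    have := mul_nonneg G.rad_coeff_nonneg (pow_nonneg (hM ▸ hM0.le) 4)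
    linarith
  obtain ⟨e, he, hep⟩ := intermediate_value_Icc hM0.le hcont ⟨h0.trans_le hp.le, h1⟩
  refine ⟨e, lt_of_le_of_ne he.1 fun h => ?_, hep⟩
  rw [← h, h0] at hep
  exact hp.ne hep

theorem energyOf_eq {ρ e : ℝ} (hρ : 0 < ρ) (he : 0 < e) : G.energyOf ρ (G.pTot ρ e) = e := by
  obtain ⟨h0, h1⟩ := G.energyOf_spec hρ (G.pTot_pos hρ he)
  exact (G.pTot_strictMonoOn hρ).injOn (mem_Ici.2 h0.le) (mem_Ici.2 he.le) h1

theorem eTotOf_pTot {ρ e : ℝ} (hρ : 0 < ρ) (he : 0 < e) :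
    G.eTotOf ρ (G.pTot ρ e) = G.eTot ρ e := by
  rw [eTotOf, G.energyOf_eq hρ he]

theorem Khat_pos {ρ e : ℝ} (hρ : 0 < ρ) (he : 0 < e) : 0 < G.Khat ρ e := by
  have h1 := G.γ_sub_one_pos
  have h2 := G.rad_nonneg
  have h3 := G.Cv_pos
  simp only [Khat, pres]
  positivity

theorem Ktilde_pos {ρ e : ℝ} (hρ : 0 < ρ) (he : 0 < e) : 0 < G.Ktilde ρ e := by
  have h2 := G.rad_nonneg
  have h3 := G.Cv_pos
  simp only [Ktilde]
  positivity

theorem hasStrictFDerivAt_pTot (ρ : ℝ) {e : ℝ} (he : e ≠ 0) :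
    HasStrictFDerivAt (fun z : ℝ × ℝ => G.pTot z.1 z.2)
      (((G.γ - 1) * e) • ContinuousLinearMap.fst ℝ ℝ ℝ +
        (G.Khat ρ e / e) • ContinuousLinearMap.snd ℝ ℝ ℝ) (ρ, e) := by
  have h1 : HasStrictFDerivAt (fun z : ℝ × ℝ => z.1) (ContinuousLinearMap.fst ℝ ℝ ℝ) (ρ, e) :=
    hasStrictFDerivAt_fst
  have h2 : HasStrictFDerivAt (fun z : ℝ × ℝ => z.2) (ContinuousLinearMap.snd ℝ ℝ ℝ) (ρ, e) :=
    hasStrictFDerivAt_snd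
  have h := ((h1.const_mul (G.γ - 1)).mul h2).add
    ((h2.pow 4).const_mul (G.rad / (3 * G.Cv ^ 4)))
  have hC := G.Cv_pos.ne'
  refine (h.congr_of_eventuallyEq
    (.of_forall fun z => (G.pTot_eq z.1 z.2).symm)).congr_fderiv ?_
  ext <;> simp [Khat, pres] <;> field_simp

theorem hasStrictFDerivAt_eTot {ρ : ℝ} (hρ : ρ ≠ 0) (e : ℝ) :
    HasStrictFDerivAt (fun z : ℝ × ℝ => G.eTot z.1 z.2)
      ((-(G.rad * G.temp e ^ 4 / ρ ^ 2)) • ContinuousLinearMap.fst ℝ ℝ ℝ +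
        (G.Ktilde ρ e / ρ) • ContinuousLinearMap.snd ℝ ℝ ℝ) (ρ, e) := by
  have h1 : HasStrictFDerivAt (fun z : ℝ × ℝ => z.1) (ContinuousLinearMap.fst ℝ ℝ ℝ) (ρ, e) :=
    hasStrictFDerivAt_fst
  have h2 : HasStrictFDerivAt (fun z : ℝ × ℝ => z.2) (ContinuousLinearMap.snd ℝ ℝ ℝ) (ρ, e) :=
    hasStrictFDerivAt_snd
  have hinv : HasStrictFDerivAt (fun z : ℝ × ℝ => z.1⁻¹)
      ((-(ρ ^ 2)⁻¹) • ContinuousLinearMap.fst ℝ ℝ ℝ) (ρ, e) :=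
    (hasStrictDerivAt_inv hρ).comp_hasStrictFDerivAt (ρ, e) h1
  have h := h2.add (((h2.pow 4).const_mul (G.rad / G.Cv ^ 4)).mul hinv)
  have hC := G.Cv_pos.ne'
  refine (h.congr_of_eventuallyEq
    (.of_forall fun z => (by rw [G.eTot_eq]; rfl))).congr_fderiv ?_
  ext <;> simp [Ktilde, temp] <;> field_simp

theorem hasStrictFDerivAt_energyOf {ρ p : ℝ} (hρ : 0 < ρ) (hp : 0 < p) :
    HasStrictFDerivAt (fun z : ℝ × ℝ => G.energyOf z.1 z.2)
      (-(G.Khat ρ (G.energyOf ρ p) / G.energyOf ρ p)⁻¹ •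
        (((G.γ - 1) * G.energyOf ρ p) • ContinuousLinearMap.fst ℝ ℝ ℝ -
          ContinuousLinearMap.snd ℝ ℝ ℝ)) (ρ, p) := by
  obtain ⟨he, hep⟩ := G.energyOf_spec hρ hp
  have hK := G.Khat_pos hρ he
  refine HasStrictFDerivAt.of_implicit
    (F := fun w : (ℝ × ℝ) × ℝ => G.pTot w.1.1 w.2 - w.1.2) ?_ (div_pos hK he).ne' ?_
  · have h1 : HasStrictFDerivAt (fun w : (ℝ × ℝ) × ℝ => (w.1.1, w.2))
        (((ContinuousLinearMap.fst ℝ ℝ ℝ).comp (ContinuousLinearMap.fst ℝ (ℝ × ℝ) ℝ)).prod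
          (ContinuousLinearMap.snd ℝ (ℝ × ℝ) ℝ)) ((ρ, p), G.energyOf ρ p) :=
      (((ContinuousLinearMap.fst ℝ ℝ ℝ).comp (ContinuousLinearMap.fst ℝ (ℝ × ℝ) ℝ)).prod
          (ContinuousLinearMap.snd ℝ (ℝ × ℝ) ℝ)).hasStrictFDerivAt
    have h2 : HasStrictFDerivAt (fun w : (ℝ × ℝ) × ℝ => w.1.2)
        ((ContinuousLinearMap.snd ℝ ℝ ℝ).comp (ContinuousLinearMap.fst ℝ (ℝ × ℝ) ℝ))
        ((ρ, p), G.energyOf ρ p) := hasStrictFDerivAt_snd.comp _ hasStrictFDerivAt_fst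
    refine (((G.hasStrictFDerivAt_pTot ρ he.ne').comp (f := fun w : (ℝ × ℝ) × ℝ => (w.1.1, w.2))
      ((ρ, p), G.energyOf ρ p) h1).sub h2).congr_fderiv ?_
    ext <;> simp
  · have hU : {w : (ℝ × ℝ) × ℝ | 0 < w.1.1 ∧ 0 < w.2} ∈ 𝓝 ((ρ, p), G.energyOf ρ p) :=
      (continuousAt_const.eventually_lt (by fun_prop) hρ).and
        (continuousAt_const.eventually_lt (by fun_prop) he)
    filter_upwards [hU] with w hw hw'
    simp only [hep, sub_self, sub_eq_zero] at hw'
    rw [← hw', G.energyOf_eq hw.1 hw.2]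

theorem hasStrictFDerivAt_eTotOf {ρ p : ℝ} (hρ : 0 < ρ) (hp : 0 < p) :
    HasStrictFDerivAt (fun z : ℝ × ℝ => G.eTotOf z.1 z.2)
      (G.eTotDρ ρ p • ContinuousLinearMap.fst ℝ ℝ ℝ +
        G.eTotDp ρ p • ContinuousLinearMap.snd ℝ ℝ ℝ) (ρ, p) := by
  obtain ⟨he, hep⟩ := G.energyOf_spec hρ hp
  have h1 : HasStrictFDerivAt (fun z : ℝ × ℝ => z.1) (ContinuousLinearMap.fst ℝ ℝ ℝ) (ρ, p) :=
    hasStrictFDerivAt_fst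
  refine ((G.hasStrictFDerivAt_eTot hρ.ne' (G.energyOf ρ p)).comp
    (f := fun z : ℝ × ℝ => (z.1, G.energyOf z.1 z.2)) (ρ, p)
    (h1.prodMk (G.hasStrictFDerivAt_energyOf hρ hp))).congr_fderiv ?_
  have hK := (G.Khat_pos hρ he).ne'
  have hC := G.Cv_pos.ne'
  have he' := he.ne'
  have hρ' := hρ.ne'
  ext
  · simp only [eTotDρ]
    set e := G.energyOf ρ p
    simp
    field_simp
    simp only [Ktilde, Khat, temp, pres]
    field_simp
    ring
  · simp only [eTotDp]
    set e := G.energyOf ρ p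
    simp
    field_simp

theorem hasDerivAt_eTotOf_left {ρ p : ℝ} (hρ : 0 < ρ) (hp : 0 < p) :
    HasDerivAt (fun r => G.eTotOf r p) (G.eTotDρ ρ p) ρ := by
  have h := (G.hasStrictFDerivAt_eTotOf hρ hp).hasFDerivAt.comp_hasDerivAt ρ
    ((hasDerivAt_id ρ).prodMk (hasDerivAt_const ρ p))
  simpa [Function.comp_def] using h

theorem hasDerivAt_eTotOf_right {ρ p : ℝ} (hρ : 0 < ρ) (hp : 0 < p) :
    HasDerivAt (fun q => G.eTotOf ρ q) (G.eTotDp ρ p) p := by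
  have h := (G.hasStrictFDerivAt_eTotOf hρ hp).hasFDerivAt.comp_hasDerivAt p
    ((hasDerivAt_const p ρ).prodMk (hasDerivAt_id p))
  simpa [Function.comp_def] using h

/-- No term of the numerator is positive, and the first is negative. This sign makes `Hden`
negative, hence gives both uniqueness and nondegeneracy of the Hugoniot density. -/
theorem eTotDρ_neg {ρ p : ℝ} (hρ : 0 < ρ) (hp : 0 < p) : G.eTotDρ ρ p < 0 := by
  obtain ⟨he, -⟩ := G.energyOf_spec hρ hp
  have h1 := G.γ_sub_one_pos
  have h2 := G.rad_nonneg
  have hK := G.Khat_pos hρ he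
  simp only [eTotDρ]
  refine div_neg_of_neg_of_pos ?_ (by positivity)
  set e := G.energyOf ρ p
  set T := G.temp e
  have a1 : 0 < 3 * (G.γ - 1) * ρ ^ 2 * e ^ 2 := by positivity
  have a2 : 0 ≤ 15 * (G.γ - 1) * ρ * e * (G.rad * T ^ 4) := by positivity
  have a3 : 0 ≤ 4 * G.rad ^ 2 * T ^ 8 := by positivity
  linarith

theorem eTotOf_pos {ρ p : ℝ} (hρ : 0 < ρ) (hp : 0 < p) : 0 < G.eTotOf ρ p := by
  obtain ⟨he, -⟩ := G.energyOf_spec hρ hp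
  have h2 := G.rad_nonneg
  simp only [eTotOf, eTot]
  positivity

theorem Hden_neg {p pb ρ : ℝ} (hp : 0 < p) (hpb : 0 < pb) (hρ : 0 < ρ) : G.Hden p pb ρ < 0 := by
  have := G.eTotDρ_neg hρ hp
  have h : 0 < (p + pb) / (2 * ρ ^ 2) := by positivity
  simp only [Hden]
  linarith

/-- Each of the two parts of the pressure is at most `p`: the gas part bounds `e`, and the radiation
part bounds `a T⁴` by `3p`. The resulting decay in `ρ` fixes the sign of the Hugoniot defect at
large density. -/
theorem eTotOf_le {ρ p : ℝ} (hρ : 0 < ρ) (hp : 0 < p) :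
    G.eTotOf ρ p ≤ (p / (G.γ - 1) + 3 * p) / ρ := by
  obtain ⟨he, hep⟩ := G.energyOf_spec hρ hp
  have h1 := G.γ_sub_one_pos
  have h2 := G.rad_nonneg
  simp only [eTotOf, eTot]
  simp only [pTot, pres] at hep
  set e := G.energyOf ρ p
  have a1 : 0 < (G.γ - 1) * ρ * e := by positivity
  have a2 : 0 ≤ G.rad * G.temp e ^ 4 := by positivity
  rw [add_div]
  refine add_le_add ?_ (div_le_div_of_nonneg_right (by linarith) hρ.le)
  rw [le_div_iff₀ hρ, le_div_iff₀ h1]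
  linarith

/-! ### The Hugoniot relation and the density function `H` -/

/-- The defect in the Hugoniot relation. -/
noncomputable def hugoniotDefect (p pb ρb ρ : ℝ) : ℝ :=
  G.eTotOf ρb pb - G.eTotOf ρ p - 1 / 2 * (pb + p) * (ρ⁻¹ - ρb⁻¹)

theorem hugoniot_iff {p pb ρb ρ : ℝ} (hρb : 0 < ρb) (hρ : 0 < ρ) :
    G.Hugoniot p pb ρb ρ ↔ G.hugoniotDefect p pb ρb ρ = 0 := by
  have : (ρb - ρ) / (ρb * ρ) = ρ⁻¹ - ρb⁻¹ := by field_simp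
  rw [Hugoniot, hugoniotDefect, this, sub_eq_zero]

/-- With `N = Hden`, the gradient is written as `N (H₁, H₂, H₃, -1)`, so that implicit
differentiation returns the `Hᵢ` by cancelling `N`. -/
theorem hasStrictFDerivAt_hugoniotDefect {p pb ρb ρ : ℝ} (hp : 0 < p) (hpb : 0 < pb)
    (hρb : 0 < ρb) (hρ : 0 < ρ) :
    HasStrictFDerivAt
      (fun w : (ℝ × ℝ × ℝ) × ℝ => G.hugoniotDefect w.1.1 w.1.2.1 w.1.2.2 w.2)
      ((G.Hden p pb ρ •
        (G.H₁ p pb ρb ρ • ContinuousLinearMap.fst ℝ ℝ (ℝ × ℝ) +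
          (G.H₂ p pb ρb ρ • ContinuousLinearMap.fst ℝ ℝ ℝ +
            G.H₃ p pb ρb ρ • ContinuousLinearMap.snd ℝ ℝ ℝ).comp
              (ContinuousLinearMap.snd ℝ ℝ (ℝ × ℝ)))).coprod
        ((-G.Hden p pb ρ) • ContinuousLinearMap.id ℝ ℝ)) ((p, pb, ρb), ρ) := by
  set Pp : (ℝ × ℝ × ℝ) × ℝ →L[ℝ] ℝ :=
    (ContinuousLinearMap.fst ℝ ℝ (ℝ × ℝ)).comp (ContinuousLinearMap.fst ℝ (ℝ × ℝ × ℝ) ℝ) with hPp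
  set Ppb : (ℝ × ℝ × ℝ) × ℝ →L[ℝ] ℝ :=
    ((ContinuousLinearMap.fst ℝ ℝ ℝ).comp (ContinuousLinearMap.snd ℝ ℝ (ℝ × ℝ))).comp
      (ContinuousLinearMap.fst ℝ (ℝ × ℝ × ℝ) ℝ) with hPpb
  set Pρb : (ℝ × ℝ × ℝ) × ℝ →L[ℝ] ℝ :=
    ((ContinuousLinearMap.snd ℝ ℝ ℝ).comp (ContinuousLinearMap.snd ℝ ℝ (ℝ × ℝ))).comp
      (ContinuousLinearMap.fst ℝ (ℝ × ℝ × ℝ) ℝ) with hPρb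
  set Pρ : (ℝ × ℝ × ℝ) × ℝ →L[ℝ] ℝ := ContinuousLinearMap.snd ℝ (ℝ × ℝ × ℝ) ℝ with hPρ
  have h1 := (G.hasStrictFDerivAt_eTotOf hρb hpb).comp (f := fun w => (Pρb w, Ppb w))
    ((p, pb, ρb), ρ) (Pρb.hasStrictFDerivAt.prodMk Ppb.hasStrictFDerivAt)
  have h2 := (G.hasStrictFDerivAt_eTotOf hρ hp).comp (f := fun w => (Pρ w, Pp w))
    ((p, pb, ρb), ρ) (Pρ.hasStrictFDerivAt.prodMk Pp.hasStrictFDerivAt)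
  have h3 : HasStrictFDerivAt (fun w => (Pρ w)⁻¹) ((-(ρ ^ 2)⁻¹) • Pρ) ((p, pb, ρb), ρ) :=
    (hasStrictDerivAt_inv hρ.ne').comp_hasStrictFDerivAt (f := Pρ) ((p, pb, ρb), ρ)
      Pρ.hasStrictFDerivAt
  have h4 : HasStrictFDerivAt (fun w => (Pρb w)⁻¹) ((-(ρb ^ 2)⁻¹) • Pρb) ((p, pb, ρb), ρ) :=
    (hasStrictDerivAt_inv hρb.ne').comp_hasStrictFDerivAt (f := Pρb) ((p, pb, ρb), ρ)
      Pρb.hasStrictFDerivAt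
  have h := (h1.sub h2).sub ((((Ppb.hasStrictFDerivAt (x := ((p, pb, ρb), ρ))).add
    Pp.hasStrictFDerivAt).const_mul (1 / 2)).mul (h3.sub h4))
  refine h.congr_fderiv ?_
  have hN := (G.Hden_neg hp hpb hρ).ne
  have hH : 2 * ρ ^ 2 * G.Hden p pb ρ = 2 * ρ ^ 2 * G.eTotDρ ρ p - (p + pb) := by
    simp only [Hden]
    field_simp
  ext <;> simp [hPp, hPpb, hPρb, hPρ, H₁, H₂, H₃] <;> field_simp <;> linarith

theorem hasDerivAt_hugoniotDefect {p pb ρb ρ : ℝ} (hp : 0 < p) (hpb : 0 < pb)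
    (hρb : 0 < ρb) (hρ : 0 < ρ) :
    HasDerivAt (fun r => G.hugoniotDefect p pb ρb r) (-G.Hden p pb ρ) ρ := by
  have h := (G.hasStrictFDerivAt_hugoniotDefect hp hpb hρb hρ).hasFDerivAt.comp_hasDerivAt ρ
    ((hasDerivAt_const ρ (p, pb, ρb)).prodMk (hasDerivAt_id ρ))
  simpa [Function.comp_def] using h

theorem strictMonoOn_hugoniotDefect {p pb ρb : ℝ} (hp : 0 < p) (hpb : 0 < pb) (hρb : 0 < ρb) :
    StrictMonoOn (G.hugoniotDefect p pb ρb) (Ioi 0) := by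
  refine strictMonoOn_of_deriv_pos (convex_Ioi 0) (fun r hr =>
    (G.hasDerivAt_hugoniotDefect hp hpb hρb hr).continuousAt.continuousWithinAt) fun r hr => ?_
  rw [interior_Ioi] at hr
  rw [(G.hasDerivAt_hugoniotDefect hp hpb hρb hr).deriv]
  exact neg_pos.2 (G.Hden_neg hp hpb hr)

theorem exists_hugoniot {p pb ρb : ℝ} (hp : 0 < p) (hpb : 0 < pb) (hρb : 0 < ρb) :
    ∃ ρ, 0 < ρ ∧ G.Hugoniot p pb ρb ρ := by
  have h1 := G.γ_sub_one_pos
  set P := 1 / 2 * (pb + p) with hP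
  have hP0 : 0 < P := by positivity
  set C := G.eTotOf ρb pb + P * ρb⁻¹ with hC
  have hC0 : 0 < C := add_pos (G.eTotOf_pos hρb hpb) (by positivity)
  -- The defect equals `C - eTotOf ρ p - P / ρ`. At `ρ = a` the terms `C` and `P / ρ` cancel,
  -- leaving a negative value; at `ρ = b` the bound `eTotOf_le` gives `eTotOf ρ p + P / ρ ≤ M / ρ =
  -- C`.
  set a := P / C with ha
  have ha0 : 0 < a := div_pos hP0 hC0
  set M := p / (G.γ - 1) + 3 * p + P with hM
  have hM0 : 0 < M := by positivity
  set b := M / C with hb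
  have hb0 : 0 < b := div_pos hM0 hC0
  have hab : a ≤ b := by
    rw [ha, hb, hM]
    gcongr
    have : 0 < p / (G.γ - 1) := by positivity
    linarith
  have hcont : ContinuousOn (G.hugoniotDefect p pb ρb) (Icc a b) := fun r hr =>
    (G.hasDerivAt_hugoniotDefect hp hpb hρb
      (ha0.trans_le hr.1)).continuousAt.continuousWithinAt
  have hfa : G.hugoniotDefect p pb ρb a ≤ 0 := by
    have e1 : P * a⁻¹ = C := by rw [ha]; field_simp
    have e2 := G.eTotOf_pos ha0 hp
    rw [hugoniotDefect, ← hP, mul_sub, e1, hC]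
    linarith
  have hfb : 0 ≤ G.hugoniotDefect p pb ρb b := by
    have e1 : M / b = C := by rw [hb]; field_simp
    have e2 := G.eTotOf_le hb0 hp
    have e3 : M / b = (p / (G.γ - 1) + 3 * p) / b + P * b⁻¹ := by rw [hM, add_div]; rfl
    rw [hugoniotDefect, ← hP, mul_sub]
    linarith
  obtain ⟨ρ, hρ, h0⟩ := intermediate_value_Icc hab hcont ⟨hfa, hfb⟩
  have hρ0 := ha0.trans_le hρ.1
  exact ⟨ρ, hρ0, (G.hugoniot_iff hρb hρ0).2 h0⟩

theorem H_spec {p pb ρb : ℝ} (hp : 0 < p) (hpb : 0 < pb) (hρb : 0 < ρb) :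
    0 < G.H p pb ρb ∧ G.Hugoniot p pb ρb (G.H p pb ρb) :=
  Classical.epsilon_spec (p := fun ρ : ℝ => 0 < ρ ∧ G.Hugoniot p pb ρb ρ)
    (G.exists_hugoniot hp hpb hρb)

theorem hugoniot_iff_eq_H {p pb ρb : ℝ} (hp : 0 < p) (hpb : 0 < pb) (hρb : 0 < ρb) (ρ : ℝ) :
    (0 < ρ ∧ G.Hugoniot p pb ρb ρ) ↔ ρ = G.H p pb ρb := by
  obtain ⟨h0, hH⟩ := G.H_spec hp hpb hρb
  refine ⟨fun ⟨hρ, h⟩ => ?_, fun h => h ▸ ⟨h0, hH⟩⟩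
  rw [G.hugoniot_iff hρb hρ] at h
  rw [G.hugoniot_iff hρb h0] at hH
  exact (G.strictMonoOn_hugoniotDefect hp hpb hρb).injOn hρ h0 (h.trans hH.symm)

theorem hasStrictFDerivAt_H {p pb ρb : ℝ} (hp : 0 < p) (hpb : 0 < pb) (hρb : 0 < ρb) :
    HasStrictFDerivAt (fun v : ℝ × ℝ × ℝ => G.H v.1 v.2.1 v.2.2)
      (G.H₁ p pb ρb (G.H p pb ρb) • ContinuousLinearMap.fst ℝ ℝ (ℝ × ℝ) +
          (G.H₂ p pb ρb (G.H p pb ρb) • ContinuousLinearMap.fst ℝ ℝ ℝ +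
            G.H₃ p pb ρb (G.H p pb ρb) • ContinuousLinearMap.snd ℝ ℝ ℝ).comp
              (ContinuousLinearMap.snd ℝ ℝ (ℝ × ℝ))) (p, pb, ρb) := by
  obtain ⟨h0, hH⟩ := G.H_spec hp hpb hρb
  have hN := (G.Hden_neg hp hpb h0).ne
  refine (HasStrictFDerivAt.of_implicit (φ := fun v : ℝ × ℝ × ℝ => G.H v.1 v.2.1 v.2.2)
    (G.hasStrictFDerivAt_hugoniotDefect hp hpb hρb h0) (neg_ne_zero.2 hN) ?_).congr_fderiv ?_
  · have hU : ∀ᶠ w : (ℝ × ℝ × ℝ) × ℝ in 𝓝 ((p, pb, ρb), G.H p pb ρb),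
        ((0 < w.1.1 ∧ 0 < w.1.2.1) ∧ 0 < w.1.2.2) ∧ 0 < w.2 :=
      (((continuousAt_const.eventually_lt (by fun_prop) hp).and
        (continuousAt_const.eventually_lt (by fun_prop) hpb)).and
        (continuousAt_const.eventually_lt (by fun_prop) hρb)).and
        (continuousAt_const.eventually_lt (by fun_prop) h0)
    filter_upwards [hU] with w hw hw'
    refine (G.hugoniot_iff_eq_H hw.1.1.1 hw.1.1.2 hw.1.2 _).1 ⟨hw.2, ?_⟩
    rw [G.hugoniot_iff hw.1.2 hw.2, hw']
    exact (G.hugoniot_iff hρb h0).1 hH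
  · rw [smul_smul, inv_neg, neg_neg, inv_mul_cancel₀ hN, one_smul]

theorem hasDerivAt_H_fst {p pb ρb : ℝ} (hp : 0 < p) (hpb : 0 < pb) (hρb : 0 < ρb) :
    HasDerivAt (fun q => G.H q pb ρb) (G.H₁ p pb ρb (G.H p pb ρb)) p := by
  have h := (G.hasStrictFDerivAt_H hp hpb hρb).hasFDerivAt.comp_hasDerivAt p
    ((hasDerivAt_id p).prodMk (hasDerivAt_const p (pb, ρb)))
  simpa [Function.comp_def] using h

theorem hasDerivAt_H_snd {p pb ρb : ℝ} (hp : 0 < p) (hpb : 0 < pb) (hρb : 0 < ρb) :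
    HasDerivAt (fun q => G.H p q ρb) (G.H₂ p pb ρb (G.H p pb ρb)) pb := by
  have h := (G.hasStrictFDerivAt_H hp hpb hρb).hasFDerivAt.comp_hasDerivAt pb
    ((hasDerivAt_const pb p).prodMk ((hasDerivAt_id pb).prodMk (hasDerivAt_const pb ρb)))
  simpa [Function.comp_def] using h

theorem hasDerivAt_H_trd {p pb ρb : ℝ} (hp : 0 < p) (hpb : 0 < pb) (hρb : 0 < ρb) :
    HasDerivAt (fun r => G.H p pb r) (G.H₃ p pb ρb (G.H p pb ρb)) ρb := by
  have h := (G.hasStrictFDerivAt_H hp hpb hρb).hasFDerivAt.comp_hasDerivAt ρb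
    ((hasDerivAt_const ρb p).prodMk ((hasDerivAt_const ρb pb).prodMk (hasDerivAt_id ρb)))
  simpa [Function.comp_def] using h

end Gas

/-! ### Partial derivatives of `Φ` -/

theorem Φ_partials {p pb ρb ρ : ℝ} (hρb : 0 < ρb) (hρ : 0 < ρ)
    (h : 0 < (p - pb) * (1 / ρb - 1 / ρ)) :
    HasDerivAt (fun q => Φ q pb ρb ρ) (ΦDp p pb ρb ρ) p ∧
      HasDerivAt (fun q => Φ p q ρb ρ) (ΦDpb p pb ρb ρ) pb ∧
      HasDerivAt (fun r => Φ p pb r ρ) (ΦDρb p pb ρb ρ) ρb ∧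
      HasDerivAt (fun r => Φ p pb ρb r) (ΦDρ p pb ρb ρ) ρ := by
  have hΦ : 0 < Φ p pb ρb ρ := Real.sqrt_pos.2 h
  have inv : ∀ {r : ℝ}, 0 < r → HasDerivAt (fun r : ℝ => 1 / r) (-(r ^ 2)⁻¹) r := fun hr => by
    simpa only [one_div] using hasDerivAt_inv hr.ne'
  refine ⟨?_, ?_, ?_, ?_⟩
  · refine (((hasDerivAt_id p).sub_const pb).mul_const (1 / ρb - 1 / ρ)).sqrt h.ne' |>.congr_deriv ?_
    simp only [ΦDp, Φ, id]
    ring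
  · refine (((hasDerivAt_id pb).const_sub p).mul_const (1 / ρb - 1 / ρ)).sqrt h.ne' |>.congr_deriv ?_
    simp only [ΦDpb, Φ, id]
    ring
  · refine (((inv hρb).sub_const (1 / ρ)).const_mul (p - pb)).sqrt h.ne' |>.congr_deriv ?_
    change _ / (2 * Φ p pb ρb ρ) = _
    simp only [ΦDρb]
    field_simp
    ring
  · refine (((inv hρ).const_sub (1 / ρb)).const_mul (p - pb)).sqrt h.ne' |>.congr_deriv ?_
    change _ / (2 * Φ p pb ρb ρ) = _
    simp only [ΦDρ]
    field_simp

end RadHydro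

/-! ### First derivatives at a boundary point -/

/-- A C¹ function on `S` has near `z₀` a derivative field continuous at `z₀`, and on the open part
this field is `fderiv`. No unique differentiability is needed at `z₀`, where the region may be a
cusp; a single `L` serves both conclusions. -/
theorem ContDiffOn.exists_tendsto_fderiv {E F : Type*} [NormedAddCommGroup E] [NormedSpace ℝ E]
    [NormedAddCommGroup F] [NormedSpace ℝ F] {f : E → F} {S O : Set E} {z₀ : E}
    (hf : ContDiffOn ℝ 1 f S) (h₀ : z₀ ∈ S) (hO : IsOpen O) (hOS : O ⊆ S) :
    ∃ L : E →L[ℝ] F, HasFDerivWithinAt f L S z₀ ∧ Tendsto (fderiv ℝ f) (𝓝[O] z₀) (𝓝 L) := by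
  have h := hf z₀ h₀
  rw [← zero_add (1 : WithTop ℕ∞),
    contDiffWithinAt_succ_iff_hasFDerivWithinAt' (by simp)] at h
  obtain ⟨u, hu, -, -, f', hf', hcont⟩ := h
  rw [insert_eq_of_mem h₀] at hu
  refine ⟨f' z₀, hf' z₀ (mem_of_mem_nhdsWithin h₀ hu), ?_⟩
  have ht : Tendsto f' (𝓝[O] z₀) (𝓝 (f' z₀)) := hcont.continuousWithinAt.mono hOS
  refine ht.congr' ?_
  filter_upwards [nhdsWithin_mono z₀ hOS hu, self_mem_nhdsWithin] with z hz hzO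
  exact ((hf' z hz).hasFDerivAt (mem_of_superset (hO.mem_nhds hzO) hOS)).fderiv.symm

theorem HasFDerivWithinAt.comp_graph {f : ℝ × ℝ → ℝ} {L : ℝ × ℝ →L[ℝ] ℝ} {S : Set (ℝ × ℝ)}
    {X : ℝ → ℝ} {σ : ℝ} (hf : HasFDerivWithinAt f L S (0, 0))
    (hX : HasDerivWithinAt X σ (Ici 0) 0) (hX₀ : X 0 = 0)
    (hS : ∀ᶠ t in 𝓝[≥] (0 : ℝ), (X t, t) ∈ S) :
    HasDerivWithinAt (fun t => f (X t, t)) (L (σ, 1)) (Ici 0) 0 := by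
  have hγ : HasDerivWithinAt (fun t : ℝ => (X t, t)) (σ, 1) (Ici 0) 0 :=
    hX.prodMk (hasDerivWithinAt_id 0 _)
  have hf' : HasFDerivWithinAt f L S ((fun t : ℝ => (X t, t)) 0) := by simpa only [hX₀] using hf
  have h := HasFDerivWithinAt.comp_of_tendsto (f := fun t : ℝ => (X t, t)) 0 hf' hγ.hasFDerivWithinAt
    (tendsto_nhdsWithin_iff.2 ⟨hγ.continuousWithinAt, hS⟩)
  simpa [Function.comp_def] using h.hasDerivWithinAt

namespace RadHydro

theorem isOpen_wedge {τ : ℝ} {l r : ℝ → ℝ} (hl : ContinuousOn l (Ico 0 τ))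
    (hr : ContinuousOn r (Ico 0 τ)) : IsOpen (wedge τ l r) := by
  rw [isOpen_iff_mem_nhds]
  rintro z ⟨ht, h1, h2⟩
  have hmem : Ico 0 τ ∈ 𝓝 z.2 := mem_of_superset (Ioo_mem_nhds ht.1 ht.2) Ioo_subset_Ico_self
  have hl' : ContinuousAt (fun w : ℝ × ℝ => l w.2) z :=
    (hl.continuousAt hmem).comp (f := Prod.snd) continuousAt_snd
  have hr' : ContinuousAt (fun w : ℝ × ℝ => r w.2) z :=
    (hr.continuousAt hmem).comp (f := Prod.snd) continuousAt_snd
  filter_upwards [continuousAt_snd.eventually (Ioo_mem_nhds ht.1 ht.2),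
    hl'.eventually_lt continuousAt_fst h1, continuousAt_fst.eventually_lt hr' h2] with w a b c
  exact ⟨a, b, c⟩

theorem wedge_subset_wedgeBar (τ : ℝ) (l r : ℝ → ℝ) : wedge τ l r ⊆ wedgeBar τ l r :=
  fun _ h => ⟨Ioo_subset_Ico_self h.1, Ioo_subset_Icc_self h.2⟩

theorem neBot_nhdsWithin_of_graph {O : Set (ℝ × ℝ)} {c : ℝ → ℝ}
    (hc : Tendsto c (𝓝[>] 0) (𝓝 0)) (hO : ∀ᶠ t in 𝓝[>] (0 : ℝ), (c t, t) ∈ O) :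
    (𝓝[O] ((0 : ℝ), (0 : ℝ))).NeBot :=
  (tendsto_nhdsWithin_iff.2
    ⟨hc.prodMk_nhds (tendsto_id.mono_left nhdsWithin_le_nhds), hO⟩).neBot

/-! ### Sound speed and jump conditions -/

namespace Gas

variable (G : Gas)

theorem cs_sq {s : State} (hρ : 0 < s.ρ) (he : 0 < s.e) :
    G.cs s ^ 2 = G.pres s.ρ s.e / s.ρ + G.Khat s.ρ s.e ^ 2 / (s.ρ * s.e * G.Ktilde s.ρ s.e) := by
  have h1 := G.γ_sub_one_pos
  have h2 := G.Ktilde_pos hρ he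
  exact Real.sq_sqrt (by simp only [pres]; positivity)

theorem cs_sq_pos {s : State} (hρ : 0 < s.ρ) (he : 0 < s.e) : 0 < G.cs s ^ 2 := by
  rw [G.cs_sq hρ he]
  have h1 := G.γ_sub_one_pos
  have h2 := G.Ktilde_pos hρ he
  simp only [pres]
  positivity

theorem continuousAt_sound {ρ e : ℝ} (hρ : 0 < ρ) (he : 0 < e) :
    ContinuousAt (fun z : ℝ × ℝ => G.sound z.1 z.2) (ρ, e) := by
  have h2 := G.Ktilde_pos hρ he
  refine ContinuousAt.sqrt (.add (.div ?_ ?_ hρ.ne') (.div ?_ ?_ (by positivity)))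
  · simp only [pres]; fun_prop
  · fun_prop
  · simp only [Khat, pres]; fun_prop
  · simp only [Ktilde]; fun_prop

/-- When `v = l.u`, the mass relation reduces to `r.ρ (r.u - v) = 0`; with equal velocities the
momentum relation leaves only the pressure jump. -/
theorem contact_relations {l r : State} {v : ℝ} (h : G.RankineHugoniot l r v) (hv : v = l.u)
    (hr : 0 < r.ρ) : r.u = v ∧ G.pt l = G.pt r := by
  simp only [RankineHugoniot, cons, flux, Prod.ext_iff, Prod.smul_fst, Prod.smul_snd,
    Prod.fst_sub, Prod.snd_sub, smul_eq_mul] at h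
  obtain ⟨h1, h2, -⟩ := h
  have hu : r.u = v := by
    have : r.ρ * (r.u - v) = 0 := by rw [hv] at h1 ⊢; linarith
    have := (mul_eq_zero.1 this).resolve_left hr.ne'
    linarith
  refine ⟨hu, ?_⟩
  rw [hu, ← hv] at h2
  linarith

theorem mass_flux_eq {l r : State} {v : ℝ} (h : G.RankineHugoniot l r v) :
    l.ρ * (v - l.u) = r.ρ * (v - r.u) := by
  have h1 := congrArg Prod.fst h
  simp only [cons, flux, Prod.smul_fst, Prod.fst_sub, smul_eq_mul] at h1
  linarith

theorem mass_flux_mul {l r : State} {v : ℝ} (h : G.RankineHugoniot l r v) :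
    l.ρ * (v - l.u) * (l.u - r.u) = G.pt l - G.pt r := by
  have h0 := G.mass_flux_eq h
  have h2 := congrArg (fun w : ℝ × ℝ × ℝ => w.2.1) h
  simp only [cons, flux, Prod.smul_fst, Prod.smul_snd, Prod.fst_sub, Prod.snd_sub,
    smul_eq_mul] at h2
  linear_combination h2 - r.u * h0

theorem sq_velocity_jump {l r : State} {v : ℝ} (h : G.RankineHugoniot l r v)
    (hl : 0 < l.ρ) (hr : 0 < r.ρ) :
    (l.u - r.u) ^ 2 = (G.pt l - G.pt r) * (r.ρ⁻¹ - l.ρ⁻¹) := by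
  rw [← G.mass_flux_mul h]
  have h0 := G.mass_flux_eq h
  field_simp
  linear_combination -(l.u - r.u) * h0

/-- The energy relation, after eliminating velocities by mass and momentum, is the mass flux times
the defect. The flux is nonzero because its product with the velocity jump is the pressure jump. -/
theorem hugoniotDefect_eq_zero {l r : State} {v : ℝ} (h : G.RankineHugoniot l r v)
    (hl : 0 < l.ρ) (hr : 0 < r.ρ) (hle : 0 < l.e) (hre : 0 < r.e) (hp : G.pt l ≠ G.pt r) :
    G.hugoniotDefect (G.pt l) (G.pt r) r.ρ l.ρ = 0 := by
  have h0 := G.mass_flux_eq h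
  have h1 := G.mass_flux_mul h
  have hm : l.ρ * (v - l.u) ≠ 0 := fun h' => hp (by rw [h', zero_mul] at h1; linarith)
  have h3 := congrArg (fun w : ℝ × ℝ × ℝ => w.2.2) h
  simp only [cons, flux, energy, Prod.smul_snd, Prod.snd_sub, smul_eq_mul] at h3
  have e1 : G.eTotOf r.ρ (G.pt r) = G.eTot r.ρ r.e := G.eTotOf_pTot hr hre
  have e2 : G.eTotOf l.ρ (G.pt l) = G.eTot l.ρ l.e := G.eTotOf_pTot hl hle
  rw [hugoniotDefect, e1, e2]
  have h4 : l.ρ * (v - l.u) * (l.ρ⁻¹ - r.ρ⁻¹) = r.u - l.u := by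
    have a : l.ρ * (v - l.u) * l.ρ⁻¹ = v - l.u := by field_simp
    have b : r.ρ * (v - r.u) * r.ρ⁻¹ = v - r.u := by field_simp
    rw [mul_sub, a, h0, b]
    ring
  refine (mul_eq_zero.1 ?_).resolve_left hm
  linear_combination -h3 + (G.eTot r.ρ r.e + 1 / 2 * r.u ^ 2) * h0 +
    (l.u + r.u) / 2 * h1 - 1 / 2 * (G.pt r + G.pt l) * h4

/-- The derivative of the velocity behind a family of shocks, in terms of the derivatives of the
pressure behind and of the state ahead. -/
theorem shock_velocity_deriv {ρ u p ρb ub pb : ℝ → ℝ} {ρ' u' p' ρb' ub' pb' : ℝ}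
    (hρ : HasDerivWithinAt ρ ρ' (Ici 0) 0) (hu : HasDerivWithinAt u u' (Ici 0) 0)
    (hp : HasDerivWithinAt p p' (Ici 0) 0) (hρb : HasDerivWithinAt ρb ρb' (Ici 0) 0)
    (hub : HasDerivWithinAt ub ub' (Ici 0) 0) (hpb : HasDerivWithinAt pb pb' (Ici 0) 0)
    (ρ_pos : 0 < ρ 0) (p_pos : 0 < p 0) (ρb_pos : 0 < ρb 0) (pb_pos : 0 < pb 0)
    (hvel : ub 0 < u 0)
    (hH : ∀ᶠ t in 𝓝[≥] (0 : ℝ), G.hugoniotDefect (p t) (pb t) (ρb t) (ρ t) = 0)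
    (hsq : ∀ᶠ t in 𝓝[≥] (0 : ℝ), (u t - ub t) ^ 2 = (p t - pb t) * ((ρb t)⁻¹ - (ρ t)⁻¹)) :
    u' - ub' = G.Φ₁ (p 0) (pb 0) (ρb 0) (ρ 0) * p' + G.Φ₂ (p 0) (pb 0) (ρb 0) (ρ 0) * pb' +
      G.Φ₃ (p 0) (pb 0) (ρb 0) (ρ 0) * ρb' := by
  have huniq := uniqueDiffWithinAt_Ici (0 : ℝ)
  have hN := (G.Hden_neg p_pos pb_pos ρ_pos).ne
  have d1 := (G.hasStrictFDerivAt_hugoniotDefect p_pos pb_pos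
    ρb_pos ρ_pos).hasFDerivAt.comp_hasDerivWithinAt (f := fun t => ((p t, pb t, ρb t), ρ t)) 0
    ((hp.prodMk (hpb.prodMk hρb)).prodMk hρ)
  have d1' : HasDerivWithinAt (fun _ : ℝ => (0 : ℝ)) 0 (Ici 0) 0 := hasDerivWithinAt_const _ _ _
  -- The defect vanishes along the shock, so its derivative does too; dividing by `Hden` gives `ρ'`
  -- in terms of `H₁`, `H₂`, `H₃`.
  have e1 := huniq.eq_deriv _ d1 (d1'.congr_of_eventuallyEq_of_mem hH self_mem_Ici)
  have hρ' : ρ' = G.H₁ (p 0) (pb 0) (ρb 0) (ρ 0) * p' + G.H₂ (p 0) (pb 0) (ρb 0) (ρ 0) * pb' +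
      G.H₃ (p 0) (pb 0) (ρb 0) (ρ 0) * ρb' := by
    refine mul_left_cancel₀ hN ?_
    simp at e1
    linarith
  -- The squared relation is differentiated, which avoids the root. The factor `2 (u - ub) = 2 Φ`
  -- that appears is the denominator in the partial derivatives of `Φ`.
  have d2 := ((hu.sub hub).pow 2)
  have d3 := (hp.sub hpb).mul ((hρb.inv ρb_pos.ne').sub (hρ.inv ρ_pos.ne'))
  have e2 := huniq.eq_deriv _ d2 (d3.congr_of_eventuallyEq_of_mem hsq self_mem_Ici)
  have hΦ : Φ (p 0) (pb 0) (ρb 0) (ρ 0) = u 0 - ub 0 := by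
    rw [Φ, one_div, one_div, ← hsq.self_of_nhdsWithin self_mem_Ici,
      Real.sqrt_sq (sub_nonneg.2 hvel.le)]
  have hw : u 0 - ub 0 ≠ 0 := (sub_pos.2 hvel).ne'
  have hρ0 := ρ_pos.ne'
  have hρb0 := ρb_pos.ne'
  simp only [Φ₁, Φ₂, Φ₃, ΦDp, ΦDpb, ΦDρb, ΦDρ, hΦ]
  simp at e2
  rw [← mul_right_inj' (mul_ne_zero two_ne_zero hw), e2]
  rw [hρ']
  field_simp
  ring

end Gas

/-! ### Balance laws in density, velocity and pressure -/

theorem hasDerivAt_slice_fst {f : ℝ × ℝ → ℝ} {z : ℝ × ℝ} (hf : DifferentiableAt ℝ f z) :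
    HasDerivAt (fun x => f (x, z.2)) (fderiv ℝ f z (1, 0)) z.1 :=
  hf.hasFDerivAt.comp_hasDerivAt z.1 ((hasDerivAt_id z.1).prodMk (hasDerivAt_const z.1 z.2))

theorem hasDerivAt_slice_snd {f : ℝ × ℝ → ℝ} {z : ℝ × ℝ} (hf : DifferentiableAt ℝ f z) :
    HasDerivAt (fun t => f (z.1, t)) (fderiv ℝ f z (0, 1)) z.2 :=
  hf.hasFDerivAt.comp_hasDerivAt z.2 ((hasDerivAt_const z.2 z.1).prodMk (hasDerivAt_id z.2))

theorem matDeriv_eq {W V : ℝ × ℝ → State} {f : State → ℝ} {O : Set (ℝ × ℝ)} {z : ℝ × ℝ}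
    (hO : IsOpen O) (hz : z ∈ O) (hWV : ∀ w ∈ O, W w = V w)
    (hf : DifferentiableAt ℝ (fun w => f (V w)) z) :
    matDeriv W f z = fderiv ℝ (fun w => f (V w)) z (0, 1) +
      (V z).u * fderiv ℝ (fun w => f (V w)) z (1, 0) := by
  have hev : (fun w => f (W w)) =ᶠ[𝓝 z] fun w => f (V w) := by
    filter_upwards [hO.mem_nhds hz] with w hw
    rw [hWV w hw]
  have hf' : DifferentiableAt ℝ (fun w => f (W w)) z := hf.congr_of_eventuallyEq hev
  rw [matDeriv, (hasDerivAt_slice_fst hf').deriv, (hasDerivAt_slice_snd hf').deriv,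
    hev.fderiv_eq, hWV z hz]

namespace Gas

variable (G : Gas)

section Curve

variable {s : ℝ → State} {ρ' u' e' x : ℝ}

theorem hasDerivAt_pt (hρ : HasDerivAt (fun x => (s x).ρ) ρ' x)
    (he : HasDerivAt (fun x => (s x).e) e' x) (e_ne : (s x).e ≠ 0) :
    HasDerivAt (fun x => G.pt (s x))
      ((G.γ - 1) * (s x).e * ρ' + G.Khat (s x).ρ (s x).e / (s x).e * e') x := by
  have h := (G.hasStrictFDerivAt_pTot (s x).ρ e_ne).hasFDerivAt.comp_hasDerivAt x
    (f := fun x => ((s x).ρ, (s x).e)) (hρ.prodMk he)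
  simpa [Function.comp_def, pt] using h

theorem hasDerivAt_eTot (hρ : HasDerivAt (fun x => (s x).ρ) ρ' x)
    (he : HasDerivAt (fun x => (s x).e) e' x) (ρ_ne : (s x).ρ ≠ 0) :
    HasDerivAt (fun x => G.eTot (s x).ρ (s x).e)
      (-(G.rad * G.temp (s x).e ^ 4 / (s x).ρ ^ 2) * ρ' +
        G.Ktilde (s x).ρ (s x).e / (s x).ρ * e') x := by
  have h := (G.hasStrictFDerivAt_eTot ρ_ne (s x).e).hasFDerivAt.comp_hasDerivAt x
    (f := fun x => ((s x).ρ, (s x).e)) (hρ.prodMk he)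
  simpa [Function.comp_def] using h

theorem hasDerivAt_energy {ε' : ℝ} (hρ : HasDerivAt (fun x => (s x).ρ) ρ' x)
    (hu : HasDerivAt (fun x => (s x).u) u' x)
    (hε : HasDerivAt (fun x => G.eTot (s x).ρ (s x).e) ε' x) :
    HasDerivAt (fun x => G.energy (s x))
      (1 / 2 * ρ' * (s x).u ^ 2 + (s x).ρ * (s x).u * u' + ρ' * G.eTot (s x).ρ (s x).e +
        (s x).ρ * ε') x := by
  refine (((hρ.const_mul (1 / 2)).mul (hu.pow 2)).add (hρ.mul hε)).congr_deriv ?_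
  simp
  ring

theorem hasDerivAt_cons {ε' : ℝ} (hρ : HasDerivAt (fun x => (s x).ρ) ρ' x)
    (hu : HasDerivAt (fun x => (s x).u) u' x)
    (hε : HasDerivAt (fun x => G.eTot (s x).ρ (s x).e) ε' x) :
    HasDerivAt (fun x => G.cons (s x))
      (ρ', ρ' * (s x).u + (s x).ρ * u',
        1 / 2 * ρ' * (s x).u ^ 2 + (s x).ρ * (s x).u * u' + ρ' * G.eTot (s x).ρ (s x).e +
        (s x).ρ * ε') x :=
  hρ.prodMk ((hρ.mul hu).prodMk (G.hasDerivAt_energy hρ hu hε))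

theorem hasDerivAt_flux {ε' p' : ℝ} (hρ : HasDerivAt (fun x => (s x).ρ) ρ' x)
    (hu : HasDerivAt (fun x => (s x).u) u' x)
    (hε : HasDerivAt (fun x => G.eTot (s x).ρ (s x).e) ε' x)
    (hp : HasDerivAt (fun x => G.pt (s x)) p' x) :
    HasDerivAt (fun x => G.flux (s x))
      (ρ' * (s x).u + (s x).ρ * u', ρ' * (s x).u ^ 2 + (s x).ρ * (2 * (s x).u * u') + p',
        u' * (G.energy (s x) + G.pt (s x)) + (s x).u *
        (1 / 2 * ρ' * (s x).u ^ 2 + (s x).ρ * (s x).u * u' + ρ' * G.eTot (s x).ρ (s x).e +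
        (s x).ρ * ε' + p')) x := by
  refine (hρ.mul hu).prodMk (HasDerivAt.prodMk ?_
    (hu.mul ((G.hasDerivAt_energy hρ hu hε).add hp)))
  refine ((hρ.mul (hu.pow 2)).add hp).congr_deriv ?_
  simp

end Curve

theorem differentiableAt_pt {V : ℝ × ℝ → State} {z : ℝ × ℝ}
    (hρ : DifferentiableAt ℝ (fun w => (V w).ρ) z) (he : DifferentiableAt ℝ (fun w => (V w).e) z) :
    DifferentiableAt ℝ (fun w => G.pt (V w)) z := by
  simp only [pt, pTot_eq]
  fun_prop

/-- The balance laws in terms of density, velocity and pressure, at a point where the flow is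
differentiable. -/
theorem primitive_form {V : ℝ × ℝ → State} {z : ℝ × ℝ}
    (hρ : DifferentiableAt ℝ (fun w => (V w).ρ) z) (hu : DifferentiableAt ℝ (fun w => (V w).u) z)
    (he : DifferentiableAt ℝ (fun w => (V w).e) z) (ρ_pos : 0 < (V z).ρ) (e_pos : 0 < (V z).e)
    (hcons : deriv (fun t => G.cons (V (z.1, t))) z.2 +
      deriv (fun x => G.flux (V (x, z.2))) z.1 = 0) :
    fderiv ℝ (fun w => (V w).ρ) z (0, 1) + (V z).u * fderiv ℝ (fun w => (V w).ρ) z (1, 0) =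
        -((V z).ρ * fderiv ℝ (fun w => (V w).u) z (1, 0)) ∧
      (V z).ρ * (fderiv ℝ (fun w => (V w).u) z (0, 1) +
        (V z).u * fderiv ℝ (fun w => (V w).u) z (1, 0)) =
        -fderiv ℝ (fun w => G.pt (V w)) z (1, 0) ∧
      fderiv ℝ (fun w => G.pt (V w)) z (0, 1) +
        (V z).u * fderiv ℝ (fun w => G.pt (V w)) z (1, 0) =
        -((V z).ρ * G.cs (V z) ^ 2 * fderiv ℝ (fun w => (V w).u) z (1, 0)) := by
  have hp := G.differentiableAt_pt hρ he
  have ρx := hasDerivAt_slice_fst hρ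
  have ρt := hasDerivAt_slice_snd hρ
  have ux := hasDerivAt_slice_fst hu
  have ut := hasDerivAt_slice_snd hu
  have ex := hasDerivAt_slice_fst he
  have et := hasDerivAt_slice_snd he
  have px := hasDerivAt_slice_fst hp
  have pt' := hasDerivAt_slice_snd hp
  have εx := G.hasDerivAt_eTot (s := fun x => V (x, z.2)) ρx ex ρ_pos.ne'
  have εt := G.hasDerivAt_eTot (s := fun t => V (z.1, t)) ρt et ρ_pos.ne'
  have px' := px.unique (G.hasDerivAt_pt (s := fun x => V (x, z.2)) ρx ex e_pos.ne')
  have pt'' := pt'.unique (G.hasDerivAt_pt (s := fun t => V (z.1, t)) ρt et e_pos.ne')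
  have C := G.hasDerivAt_cons (s := fun t => V (z.1, t)) ρt ut εt
  have F := G.hasDerivAt_flux (s := fun x => V (x, z.2)) ρx ux εx px
  rw [C.deriv, F.deriv] at hcons
  simp only [Prod.mk_add_mk, Prod.mk_eq_zero, Prod.mk.eta] at hcons px' pt''
  obtain ⟨h1, h2, h3⟩ := hcons
  rw [G.cs_sq ρ_pos e_pos]
  generalize fderiv ℝ (fun w => G.pt (V w)) z (1, 0) = Px at *
  generalize fderiv ℝ (fun w => G.pt (V w)) z (0, 1) = Pt at *
  generalize fderiv ℝ (fun w => (V w).ρ) z (1, 0) = Rx at *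
  generalize fderiv ℝ (fun w => (V w).ρ) z (0, 1) = Rt at *
  generalize fderiv ℝ (fun w => (V w).u) z (1, 0) = Ux at *
  generalize fderiv ℝ (fun w => (V w).u) z (0, 1) = Ut at *
  generalize fderiv ℝ (fun w => (V w).e) z (1, 0) = Ex at *
  generalize fderiv ℝ (fun w => (V w).e) z (0, 1) = Et at *
  have k1 : Rt + (V z).u * Rx = -((V z).ρ * Ux) := by linear_combination h1
  have k2 : (V z).ρ * (Ut + (V z).u * Ux) = -Px := by linear_combination h2 - (V z).u * h1
  refine ⟨k1, k2, ?_⟩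
  have hρ0 := ρ_pos.ne'
  have he0 := e_pos.ne'
  have hC := G.Cv_pos.ne'
  have hKt := (G.Ktilde_pos ρ_pos e_pos).ne'
  have hpt : G.pt (V z) + G.rad * G.temp (V z).e ^ 4 = G.Khat (V z).ρ (V z).e := by
    simp only [pt, pTot, Khat, temp]
    field_simp
    ring
  -- Removing the mass and momentum balances from the energy balance leaves `ρ De_tot/Dt = -p_tot
  -- ∂ₓu`. The dependence of `e_tot` on `ρ` contributes a further `a T⁴ ∂ₓu`, and `p_tot + a T⁴ =
  -- K̂`.
  have k3 : G.Ktilde (V z).ρ (V z).e * (Et + (V z).u * Ex) =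
      -(G.Khat (V z).ρ (V z).e * Ux) := by
    simp only [energy] at h3
    have a1 : (V z).ρ * (-(G.rad * G.temp (V z).e ^ 4 / (V z).ρ ^ 2) * Rt +
        G.Ktilde (V z).ρ (V z).e / (V z).ρ * Et) =
        -(G.rad * G.temp (V z).e ^ 4 / (V z).ρ) * Rt + G.Ktilde (V z).ρ (V z).e * Et := by
      field_simp
    have a2 : (V z).ρ * (-(G.rad * G.temp (V z).e ^ 4 / (V z).ρ ^ 2) * Rx +
        G.Ktilde (V z).ρ (V z).e / (V z).ρ * Ex) =
        -(G.rad * G.temp (V z).e ^ 4 / (V z).ρ) * Rx + G.Ktilde (V z).ρ (V z).e * Ex := by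
      field_simp
    have a3 : G.rad * G.temp (V z).e ^ 4 / (V z).ρ * ((V z).ρ * Ux) =
      G.rad * G.temp (V z).e ^ 4 * Ux := by field_simp
    rw [a1, a2] at h3
    linear_combination h3 - (1 / 2 * (V z).u ^ 2 + G.eTot (V z).ρ (V z).e) * h1 -
      (V z).u * k2 + G.rad * G.temp (V z).e ^ 4 / (V z).ρ * k1 - a3 - Ux * hpt
  have k3' : Et + (V z).u * Ex =
      -(G.Khat (V z).ρ (V z).e * Ux) / G.Ktilde (V z).ρ (V z).e := by
    rw [eq_div_iff hKt, ← k3, mul_comm]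
  -- The chain rule for `p_tot(ρ, e)`; inserting `Dρ/Dt` and `De/Dt` produces `p + K̂² / (e K̃) = ρ
  -- c²`.
  have : Pt + (V z).u * Px = (G.γ - 1) * (V z).e * (Rt + (V z).u * Rx) +
      G.Khat (V z).ρ (V z).e / (V z).e * (Et + (V z).u * Ex) := by
    rw [px', pt'']
    ring
  rw [this, k1, k3']
  simp only [pres]
  field_simp
  ring

end Gas

/-! ### Limits of first derivatives of a smooth flow at the origin -/

/-- Derivatives `Lρ`, `Lu`, `Lp` at the origin of density, velocity and pressure of the flow `V`,
relative to `S`, satisfying the balance laws. -/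
structure IsFlowJet (G : Gas) (V : ℝ × ℝ → State) (S : Set (ℝ × ℝ))
    (Lρ Lu Lp : ℝ × ℝ →L[ℝ] ℝ) : Prop where
  ρ_deriv : HasFDerivWithinAt (fun z => (V z).ρ) Lρ S (0, 0)
  u_deriv : HasFDerivWithinAt (fun z => (V z).u) Lu S (0, 0)
  p_deriv : HasFDerivWithinAt (fun z => G.pt (V z)) Lp S (0, 0)
  mass : Lρ (0, 1) + (V (0, 0)).u * Lρ (1, 0) = -((V (0, 0)).ρ * Lu (1, 0))
  momentum : (V (0, 0)).ρ * (Lu (0, 1) + (V (0, 0)).u * Lu (1, 0)) = -Lp (1, 0)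
  pressure : Lp (0, 1) + (V (0, 0)).u * Lp (1, 0) =
    -((V (0, 0)).ρ * G.cs (V (0, 0)) ^ 2 * Lu (1, 0))

namespace IsSmoothPiece

variable {G : Gas} {τ : ℝ} {l r : ℝ → ℝ} {W V : ℝ × ℝ → State}

theorem smooth_p (h : IsSmoothPiece G τ l r W V) :
    ContDiffOn ℝ 1 (fun z => G.pt (V z)) (wedgeBar τ l r) := by
  have h1 := h.smooth_ρ
  have h2 := h.smooth_e
  simp only [Gas.pt, Gas.pTot_eq]
  fun_prop

theorem differentiableAt (hO : IsOpen (wedge τ l r)) {f : ℝ × ℝ → ℝ}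
    (hf : ContDiffOn ℝ 1 f (wedgeBar τ l r)) {z : ℝ × ℝ} (hz : z ∈ wedge τ l r) :
    DifferentiableAt ℝ f z :=
  ((hf.mono (wedge_subset_wedgeBar τ l r)).contDiffAt (hO.mem_nhds hz)).differentiableAt
    one_ne_zero

theorem tendsto_matDeriv (h : IsSmoothPiece G τ l r W V) (h₀ : (0, 0) ∈ wedgeBar τ l r)
    (hO : IsOpen (wedge τ l r)) {f : State → ℝ}
    (hf : ContDiffOn ℝ 1 (fun z => f (V z)) (wedgeBar τ l r)) {L : ℝ × ℝ →L[ℝ] ℝ}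
    (hL : Tendsto (fderiv ℝ fun z => f (V z)) (𝓝[wedge τ l r] (0, 0)) (𝓝 L)) :
    Tendsto (matDeriv W f) (𝓝[wedge τ l r] (0, 0)) (𝓝 (L ((V (0, 0)).u, 1))) := by
  have hsub := wedge_subset_wedgeBar τ l r
  have hu : Tendsto (fun z => (V z).u) (𝓝[wedge τ l r] (0, 0)) (𝓝 (V (0, 0)).u) :=
    (h.smooth_u.continuousOn.continuousWithinAt h₀).mono hsub
  have happ : ∀ v, Tendsto (fun z => fderiv ℝ (fun z => f (V z)) z v)
      (𝓝[wedge τ l r] (0, 0)) (𝓝 (L v)) := fun v =>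
    ((ContinuousLinearMap.apply ℝ ℝ v).continuous.tendsto L).comp hL
  have hv : L ((V (0, 0)).u, 1) = L (0, 1) + (V (0, 0)).u * L (1, 0) := by
    rw [← smul_eq_mul, ← map_smul, ← map_add]
    simp
  rw [hv]
  refine ((happ (0, 1)).add (hu.mul (happ (1, 0)))).congr' ?_
  filter_upwards [self_mem_nhdsWithin] with z hz
  exact (matDeriv_eq hO hz h.eq (differentiableAt hO hf hz)).symm

/-- The balance laws hold inside the open wedge and pass to the limit by continuity of the
derivatives and of the sound speed. Uniqueness of limits needs the wedge to accumulate at the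
origin. -/
theorem exists_flowJet (h : IsSmoothPiece G τ l r W V) (h₀ : (0, 0) ∈ wedgeBar τ l r)
    (hO : IsOpen (wedge τ l r)) (hne : (𝓝[wedge τ l r] ((0 : ℝ), (0 : ℝ))).NeBot) :
    ∃ Lρ Lu Lp, IsFlowJet G V (wedgeBar τ l r) Lρ Lu Lp ∧
      Tendsto (matDeriv W State.u) (𝓝[wedge τ l r] (0, 0)) (𝓝 (Lu ((V (0, 0)).u, 1))) ∧
      Tendsto (matDeriv W G.pt) (𝓝[wedge τ l r] (0, 0)) (𝓝 (Lp ((V (0, 0)).u, 1))) := by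
  have hsub := wedge_subset_wedgeBar τ l r
  obtain ⟨Lρ, dρ, tρ⟩ := h.smooth_ρ.exists_tendsto_fderiv h₀ hO hsub
  obtain ⟨Lu, du, tu⟩ := h.smooth_u.exists_tendsto_fderiv h₀ hO hsub
  obtain ⟨Lp, dp, tp⟩ := h.smooth_p.exists_tendsto_fderiv h₀ hO hsub
  have cρ : Tendsto (fun z => (V z).ρ) (𝓝[wedge τ l r] (0, 0)) (𝓝 (V (0, 0)).ρ) :=
    (h.smooth_ρ.continuousOn.continuousWithinAt h₀).mono hsub
  have cu : Tendsto (fun z => (V z).u) (𝓝[wedge τ l r] (0, 0)) (𝓝 (V (0, 0)).u) :=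
    (h.smooth_u.continuousOn.continuousWithinAt h₀).mono hsub
  have ce : Tendsto (fun z => (V z).e) (𝓝[wedge τ l r] (0, 0)) (𝓝 (V (0, 0)).e) :=
    (h.smooth_e.continuousOn.continuousWithinAt h₀).mono hsub
  have cc : Tendsto (fun z => G.cs (V z)) (𝓝[wedge τ l r] (0, 0)) (𝓝 (G.cs (V (0, 0)))) :=
    (G.continuousAt_sound (h.ρ_pos _ h₀) (h.e_pos _ h₀)).tendsto.comp (cρ.prodMk_nhds ce)
  have happ : ∀ {f : ℝ × ℝ → ℝ} {L : ℝ × ℝ →L[ℝ] ℝ} (v : ℝ × ℝ),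
      Tendsto (fderiv ℝ f) (𝓝[wedge τ l r] (0, 0)) (𝓝 L) →
      Tendsto (fun z => fderiv ℝ f z v) (𝓝[wedge τ l r] (0, 0)) (𝓝 (L v)) := fun {_ L} v hL =>
    ((ContinuousLinearMap.apply ℝ ℝ v).continuous.tendsto L).comp hL
  have hprim : ∀ z ∈ wedge τ l r, _ := fun z hz => G.primitive_form
    (differentiableAt hO h.smooth_ρ hz) (differentiableAt hO h.smooth_u hz)
    (differentiableAt hO h.smooth_e hz) (h.ρ_pos z (hsub hz)) (h.e_pos z (hsub hz))
    (h.conservation z hz)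
  refine ⟨Lρ, Lu, Lp, ⟨dρ, du, dp, ?_, ?_, ?_⟩, h.tendsto_matDeriv h₀ hO h.smooth_u tu,
    h.tendsto_matDeriv h₀ hO h.smooth_p tp⟩
  · refine tendsto_nhds_unique_of_eventuallyEq ((happ (0, 1) tρ).add (cu.mul (happ (1, 0) tρ)))
      (cρ.mul (happ (1, 0) tu)).neg ?_
    filter_upwards [self_mem_nhdsWithin] with z hz using (hprim z hz).1
  · refine tendsto_nhds_unique_of_eventuallyEq
      (cρ.mul ((happ (0, 1) tu).add (cu.mul (happ (1, 0) tu)))) (happ (1, 0) tp).neg ?_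
    filter_upwards [self_mem_nhdsWithin] with z hz using (hprim z hz).2.1
  · refine tendsto_nhds_unique_of_eventuallyEq ((happ (0, 1) tp).add (cu.mul (happ (1, 0) tp)))
      ((cρ.mul (cc.pow 2)).mul (happ (1, 0) tu)).neg ?_
    filter_upwards [self_mem_nhdsWithin] with z hz using (hprim z hz).2.2

end IsSmoothPiece

end RadHydro

/-! ### The linear relation at the origin -/

theorem HasDerivWithinAt.nonneg_of_eventually_nonneg {f : ℝ → ℝ} {f' : ℝ}
    (hf : HasDerivWithinAt f f' (Ici 0) 0) (h₀ : f 0 = 0)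
    (hpos : ∀ᶠ t in 𝓝[>] (0 : ℝ), 0 ≤ f t) : 0 ≤ f' := by
  have h := (hasDerivWithinAt_iff_tendsto_slope' self_notMem_Ioi).1 hf.Ioi_of_Ici
  refine ge_of_tendsto h ?_
  filter_upwards [hpos, self_mem_nhdsWithin] with t ht ht0
  rw [slope_def_field, h₀, sub_zero, sub_zero]
  exact div_nonneg ht (le_of_lt ht0)

theorem HasFDerivWithinAt.comp_initial_line {f : ℝ × ℝ → ℝ} {L : ℝ × ℝ →L[ℝ] ℝ}
    {S : Set (ℝ × ℝ)} (hf : HasFDerivWithinAt f L S (0, 0))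
    (hS : ∀ᶠ x in 𝓝[≥] (0 : ℝ), (x, 0) ∈ S) :
    HasDerivWithinAt (fun x => f (x, 0)) (L (1, 0)) (Ici 0) 0 := by
  have hγ : HasDerivWithinAt (fun x : ℝ => (x, (0 : ℝ))) (1, 0) (Ici 0) 0 :=
    (hasDerivWithinAt_id 0 _).prodMk (hasDerivWithinAt_const _ _ _)
  have h := HasFDerivWithinAt.comp_of_tendsto (f := fun x : ℝ => (x, (0 : ℝ))) 0 hf
    hγ.hasFDerivWithinAt (tendsto_nhdsWithin_iff.2 ⟨hγ.continuousWithinAt, hS⟩)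
  simpa [Function.comp_def] using h.hasDerivWithinAt

namespace RadHydro

theorem apply_prod_one (L : ℝ × ℝ →L[ℝ] ℝ) (a : ℝ) :
    L (a, 1) = L (0, 1) + a * L (1, 0) := by
  rw [← smul_eq_mul, ← map_smul, ← map_add]
  simp

/-- The linear relation between the material derivatives behind the shock and the slopes of the
state ahead, from the differentiated jump conditions `hshock`. -/
theorem IsFlowJet.linear_relation {G : Gas} {V₂ V₃ : ℝ × ℝ → State} {S₂ S₃ : Set (ℝ × ℝ)}
    {Lρ₂ Lu₂ Lp₂ Lρ₃ Lu₃ Lp₃ : ℝ × ℝ →L[ℝ] ℝ}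
    (j₂ : IsFlowJet G V₂ S₂ Lρ₂ Lu₂ Lp₂) (j₃ : IsFlowJet G V₃ S₃ Lρ₃ Lu₃ Lp₃) {s r : State}
    (hs : V₂ (0, 0) = s) (hr : V₃ (0, 0) = r)
    (hρ₂ : 0 < s.ρ) (he₂ : 0 < s.e) (hρ₃ : 0 < r.ρ)
    {σ : ℝ} (hσ : σ = shockSpeed s r)
    (hshock : Lu₂ (σ, 1) - Lu₃ (σ, 1) = G.Φ₁ (G.pt s) (G.pt r) r.ρ s.ρ * Lp₂ (σ, 1) +
      G.Φ₂ (G.pt s) (G.pt r) r.ρ s.ρ * Lp₃ (σ, 1) + G.Φ₃ (G.pt s) (G.pt r) r.ρ s.ρ * Lρ₃ (σ, 1)) :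
    G.coeffA s r * Lu₂ (s.u, 1) + G.coeffB s r * Lp₂ (s.u, 1) =
      G.coeffD s r (Lp₃ (1, 0)) (Lu₃ (1, 0)) (Lρ₃ (1, 0)) := by
  obtain ⟨-, -, -, -, mom₂, pr₂⟩ := j₂
  obtain ⟨-, -, -, mass₃, mom₃, pr₃⟩ := j₃
  simp only [hs, hr] at mom₂ pr₂ mass₃ mom₃ pr₃
  have hc : G.cs s ≠ 0 := pow_ne_zero_iff two_ne_zero |>.1 (G.cs_sq_pos hρ₂ he₂).ne'
  simp only [Gas.coeffA, Gas.coeffB, Gas.coeffD, Gas.coeffLp, Gas.coeffLu, Gas.coeffLρ, ← hσ]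
  simp only [apply_prod_one _ σ] at hshock
  simp only [apply_prod_one _ s.u]
  -- Behind the shock `∂ₓu = -(Dp/Dt) / (ρ c²)`: this is the origin of the first term of `b_R`.
  have hB : (σ - s.u) / (s.ρ * G.cs s ^ 2) * (Lp₂ (0, 1) + s.u * Lp₂ (1, 0)) =
      -((σ - s.u) * Lu₂ (1, 0)) := by
    rw [pr₂]
    field_simp
  have hL : 1 / r.ρ * Lp₃ (1, 0) = -(Lu₃ (0, 1) + r.u * Lu₃ (1, 0)) := by
    rw [← neg_eq_iff_eq_neg.2 mom₃]
    field_simp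
  generalize G.Φ₁ (G.pt s) (G.pt r) r.ρ s.ρ = φ₁ at *
  generalize G.Φ₂ (G.pt s) (G.pt r) r.ρ s.ρ = φ₂ at *
  generalize G.Φ₃ (G.pt s) (G.pt r) r.ρ s.ρ = φ₃ at *
  linear_combination hshock - hB + hL + (σ - s.u) * φ₁ * mom₂ + φ₂ * pr₃ + φ₃ * mass₃

theorem IsLocalGRPSolution.linear_relation {G : Gas} {UR UR' : ℝ × ℝ × ℝ} {τ δ : ℝ}
    {y ξ X : ℝ → ℝ} {W W₁ W₂ W₃ : ℝ × ℝ → State}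
    (h : IsLocalGRPSolution G UR UR' τ δ y ξ X W W₁ W₂ W₃) {s r : State}
    (hs : W₂ (0, 0) = s) (hr : W₃ (0, 0) = r) :
    s.ρ = G.H (G.pt s) (G.pt r) r.ρ ∧
      s.u = r.u + Φ (G.pt s) (G.pt r) r.ρ s.ρ ∧
      derivWithin X (Ico 0 τ) 0 = shockSpeed s r ∧
      ∃ Du Dp : ℝ,
        Tendsto (matDeriv W State.u) (𝓝[wedge τ y ξ ∪ wedge τ ξ X] (0, 0)) (𝓝 Du) ∧
        Tendsto (matDeriv W G.pt) (𝓝[wedge τ y ξ ∪ wedge τ ξ X] (0, 0)) (𝓝 Dp) ∧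
        G.coeffA s r * Du + G.coeffB s r * Dp =
          G.coeffD s r (initialSlope W₃ G.pt) (initialSlope W₃ State.u)
            (initialSlope W₃ State.ρ) := by
  have hτ := h.τ_pos
  have hδ := h.δ_pos
  have ξ₀ := h.ξ_zero
  have X₀ := h.X_zero
  have m₀ : (0 : ℝ) ∈ Ico 0 τ := left_mem_Ico.2 hτ
  have hIco : Ico 0 τ ∈ 𝓝[≥] (0 : ℝ) := Ico_mem_nhdsGE hτ
  have hIoo : Ioo 0 τ ∈ 𝓝[>] (0 : ℝ) := Ioo_mem_nhdsGT hτ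
  set σ := derivWithin X (Ico 0 τ) 0 with hσ
  set v := derivWithin ξ (Ico 0 τ) 0 with hv
  have dX : HasDerivWithinAt X σ (Ici 0) 0 :=
    ((h.X_smooth.differentiableOn one_ne_zero) 0 m₀).hasDerivWithinAt.mono_of_mem_nhdsWithin hIco
  have dξ : HasDerivWithinAt ξ v (Ici 0) 0 :=
    ((h.ξ_smooth.differentiableOn one_ne_zero) 0 m₀).hasDerivWithinAt.mono_of_mem_nhdsWithin hIco
  have cy : ContinuousWithinAt y (Ici 0) 0 := (h.y_cont 0 m₀).mono_of_mem_nhdsWithin hIco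
  have to_zero : ∀ {f : ℝ → ℝ}, ContinuousWithinAt f (Ici 0) 0 → f 0 = 0 →
      Tendsto f (𝓝[>] 0) (𝓝 0) := fun {f} hf hf₀ => by
    have := hf.tendsto.mono_left (nhdsWithin_mono 0 Ioi_subset_Ici_self)
    rwa [hf₀] at this
  have ty := to_zero cy h.y_zero
  have tξ := to_zero dξ.continuousWithinAt ξ₀
  have tX := to_zero dX.continuousWithinAt X₀
  -- the three regions
  have O₁ : IsOpen (wedge τ y ξ) := isOpen_wedge h.y_cont h.ξ_smooth.continuousOn
  have O₂ : IsOpen (wedge τ ξ X) :=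
    isOpen_wedge h.ξ_smooth.continuousOn h.X_smooth.continuousOn
  have O₃ : IsOpen (wedge τ X fun _ => δ) := isOpen_wedge h.X_smooth.continuousOn continuousOn_const
  have z₁ : ((0 : ℝ), (0 : ℝ)) ∈ wedgeBar τ y ξ := ⟨m₀, h.y_zero.le, ξ₀.ge⟩
  have z₂ : ((0 : ℝ), (0 : ℝ)) ∈ wedgeBar τ ξ X := ⟨m₀, ξ₀.le, X₀.ge⟩
  have z₃ : ((0 : ℝ), (0 : ℝ)) ∈ wedgeBar τ X fun _ => δ := ⟨m₀, X₀.le, hδ.le⟩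
  have n₁ : (𝓝[wedge τ y ξ] ((0 : ℝ), (0 : ℝ))).NeBot := by
    refine neBot_nhdsWithin_of_graph (c := fun t => (y t + ξ t) / 2) ?_ ?_
    · simpa using (ty.add tξ).div_const 2
    · filter_upwards [hIoo] with t ht
      have := h.y_lt_ξ t ht
      exact ⟨ht, left_lt_add_div_two.2 this, add_div_two_lt_right.2 this⟩
  have n₂ : (𝓝[wedge τ ξ X] ((0 : ℝ), (0 : ℝ))).NeBot := by
    refine neBot_nhdsWithin_of_graph (c := fun t => (ξ t + X t) / 2) ?_ ?_
    · simpa using (tξ.add tX).div_const 2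
    · filter_upwards [hIoo] with t ht
      have := h.ξ_lt_X t ht
      exact ⟨ht, left_lt_add_div_two.2 this, add_div_two_lt_right.2 this⟩
  have n₃ : (𝓝[wedge τ X fun _ => δ] ((0 : ℝ), (0 : ℝ))).NeBot := by
    have tc : Tendsto (fun t => X t + t) (𝓝[>] 0) (𝓝 0) := by
      simpa using tX.add (tendsto_id.mono_left nhdsWithin_le_nhds : Tendsto id (𝓝[>] 0) (𝓝 (0:ℝ)))
    refine neBot_nhdsWithin_of_graph tc ?_
    filter_upwards [hIoo, tc.eventually_lt_const hδ] with t ht htδ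
    exact ⟨ht, lt_add_of_pos_right _ ht.1, htδ⟩
  obtain ⟨Lρ₁, Lu₁, Lp₁, j₁, tu₁, tp₁⟩ := h.piece₁.exists_flowJet z₁ O₁ n₁
  obtain ⟨Lρ₂, Lu₂, Lp₂, j₂, tu₂, tp₂⟩ := h.piece₂.exists_flowJet z₂ O₂ n₂
  obtain ⟨Lρ₃, Lu₃, Lp₃, j₃, -, -⟩ := h.piece₃.exists_flowJet z₃ O₃ n₃
  -- the curves as parts of the closed regions
  have ξX : ∀ t ∈ Ico 0 τ, ξ t ≤ X t := fun t ht => by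
    rcases ht.1.eq_or_lt with rfl | h0
    · rw [ξ₀, X₀]
    · exact (h.ξ_lt_X t ⟨h0, ht.2⟩).le
  have yξ : ∀ t ∈ Ico 0 τ, y t ≤ ξ t := fun t ht => by
    rcases ht.1.eq_or_lt with rfl | h0
    · rw [ξ₀, h.y_zero]
    · exact (h.y_lt_ξ t ⟨h0, ht.2⟩).le
  have c₁ : ∀ t ∈ Ico 0 τ, (ξ t, t) ∈ wedgeBar τ y ξ := fun t ht => ⟨ht, yξ t ht, le_rfl⟩
  have c₂ : ∀ t ∈ Ico 0 τ, (ξ t, t) ∈ wedgeBar τ ξ X := fun t ht => ⟨ht, le_rfl, ξX t ht⟩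
  have s₂ : ∀ t ∈ Ico 0 τ, (X t, t) ∈ wedgeBar τ ξ X := fun t ht => ⟨ht, ξX t ht, le_rfl⟩
  have hXδ : ∀ᶠ t in 𝓝[≥] (0 : ℝ), X t < δ :=
    dX.continuousWithinAt.tendsto.eventually_lt_const (by rwa [X₀])
  have s₃ : ∀ᶠ t in 𝓝[≥] (0 : ℝ), (X t, t) ∈ wedgeBar τ X fun _ => δ := by
    filter_upwards [hIco, hXδ] with t ht htδ using ⟨ht, le_rfl, htδ.le⟩
  have ev_of : ∀ {P : ℝ → Prop}, (∀ t ∈ Ico 0 τ, P t) → ∀ᶠ t in 𝓝[≥] (0 : ℝ), P t :=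
    fun hP => mem_of_superset hIco hP
  have huniq := uniqueDiffWithinAt_Ici (0 : ℝ)
  -- the contact discontinuity
  have contact : ∀ t ∈ Ico 0 τ, (W₂ (ξ t, t)).u = (W₁ (ξ t, t)).u ∧
      G.pt (W₂ (ξ t, t)) = G.pt (W₁ (ξ t, t)) := fun t ht => by
    obtain ⟨a, b⟩ := G.contact_relations (h.contact_RH t ht) (h.contact_speed t ht)
      (h.piece₂.ρ_pos _ (c₂ t ht))
    exact ⟨a.trans (h.contact_speed t ht), b.symm⟩
  have hv₁ : (W₁ (0, 0)).u = v := by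
    have := h.contact_speed 0 m₀
    rw [ξ₀] at this
    exact this.symm
  have hv₂ : s.u = v := by
    have := (contact 0 m₀).1
    rwa [ξ₀, hs, hv₁] at this
  -- As `v` is the fluid velocity, `(v, 1)` is both tangent to the contact and the direction of
  -- `D/Dt`.
  have eu : Lu₁ (v, 1) = Lu₂ (v, 1) :=
    huniq.eq_deriv _ (j₁.u_deriv.comp_graph dξ ξ₀ (ev_of c₁))
      ((j₂.u_deriv.comp_graph dξ ξ₀ (ev_of c₂)).congr_of_eventuallyEq_of_mem
        (ev_of fun t ht => (contact t ht).1.symm) self_mem_Ici)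
  have ep : Lp₁ (v, 1) = Lp₂ (v, 1) :=
    huniq.eq_deriv _ (j₁.p_deriv.comp_graph dξ ξ₀ (ev_of c₁))
      ((j₂.p_deriv.comp_graph dξ ξ₀ (ev_of c₂)).congr_of_eventuallyEq_of_mem
        (ev_of fun t ht => (contact t ht).2.symm) self_mem_Ici)
  -- the shock
  have hρs : 0 < s.ρ := hs ▸ h.piece₂.ρ_pos _ z₂
  have hes : 0 < s.e := hs ▸ h.piece₂.e_pos _ z₂
  have hρr : 0 < r.ρ := hr ▸ h.piece₃.ρ_pos _ z₃
  have her : 0 < r.e := hr ▸ h.piece₃.e_pos _ z₃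
  have hps : 0 < G.pt s := G.pTot_pos hρs hes
  have hpr : 0 < G.pt r := G.pTot_pos hρr her
  have hcomp : G.pt r < G.pt s := by
    have := h.shock_compressive
    rwa [hs, hr] at this
  have RH₀ : G.RankineHugoniot s r σ := by
    have := h.shock_RH 0 m₀
    rwa [X₀, hs, hr] at this
  -- The shock stays to the right of the contact, so the mass flux `ρ (σ - u)` behind it is
  -- nonnegative. Its product with the velocity jump is the positive pressure jump, hence `r.u <
  -- s.u`, and the root in `Φ` carries the plus sign.
  have hvσ : v ≤ σ := by
    refine sub_nonneg.1 ((dX.sub dξ).nonneg_of_eventually_nonneg (by simp [X₀, ξ₀]) ?_)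
    filter_upwards [hIoo] with t ht
    exact sub_nonneg.2 (h.ξ_lt_X t ht).le
  have hvel : r.u < s.u := by
    have h1 := G.mass_flux_mul RH₀
    by_contra! hle
    have h2 : 0 ≤ s.ρ * (σ - s.u) := mul_nonneg hρs.le (by linarith)
    have h3 := mul_nonpos_of_nonneg_of_nonpos h2 (sub_nonpos.2 hle)
    linarith
  have hsq := G.sq_velocity_jump RH₀ hρs hρr
  have hΦ : s.u = r.u + Φ (G.pt s) (G.pt r) r.ρ s.ρ := by
    rw [Φ, one_div, one_div, ← hsq, Real.sqrt_sq (sub_nonneg.2 hvel.le)]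
    ring
  have hρne : s.ρ - r.ρ ≠ 0 := fun h0 => by
    rw [sub_eq_zero.1 h0, sub_self, mul_zero] at hsq
    exact (sub_pos.2 hvel).ne' (pow_eq_zero_iff two_ne_zero |>.1 hsq)
  have hσ' : σ = shockSpeed s r := by
    rw [shockSpeed, eq_div_iff hρne]
    linear_combination G.mass_flux_eq RH₀
  have hH : s.ρ = G.H (G.pt s) (G.pt r) r.ρ :=
    (G.hugoniot_iff_eq_H hps hpr hρr _).1 ⟨hρs, (G.hugoniot_iff hρr hρs).2
      (G.hugoniotDefect_eq_zero RH₀ hρs hρr hes her hcomp.ne')⟩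
  have dρ₂ := j₂.ρ_deriv.comp_graph dX X₀ (ev_of s₂)
  have du₂ := j₂.u_deriv.comp_graph dX X₀ (ev_of s₂)
  have dp₂ := j₂.p_deriv.comp_graph dX X₀ (ev_of s₂)
  have dρ₃ := j₃.ρ_deriv.comp_graph dX X₀ s₃
  have du₃ := j₃.u_deriv.comp_graph dX X₀ s₃
  have dp₃ := j₃.p_deriv.comp_graph dX X₀ s₃
  -- The pressure jump is assumed at the origin only; continuity extends it to small `t`, where the
  -- Hugoniot relation requires it.
  have hlt : ∀ᶠ t in 𝓝[≥] (0 : ℝ), G.pt (W₃ (X t, t)) < G.pt (W₂ (X t, t)) := by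
    refine dp₃.continuousWithinAt.tendsto.eventually_lt dp₂.continuousWithinAt.tendsto ?_
    rwa [X₀, hs, hr]
  have hshock := G.shock_velocity_deriv dρ₂ du₂ dp₂ dρ₃ du₃ dp₃
    (by rwa [X₀, hs]) (by rwa [X₀, hs]) (by rwa [X₀, hr]) (by rwa [X₀, hr])
    (by rwa [X₀, hs, hr])
    (by
      filter_upwards [hIco, s₃, hlt] with t ht ht₃ htp
      exact G.hugoniotDefect_eq_zero (h.shock_RH t ht) (h.piece₂.ρ_pos _ (s₂ t ht))
        (h.piece₃.ρ_pos _ ht₃) (h.piece₂.e_pos _ (s₂ t ht)) (h.piece₃.e_pos _ ht₃) htp.ne')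
    (by
      filter_upwards [hIco, s₃] with t ht ht₃
      exact G.sq_velocity_jump (h.shock_RH t ht) (h.piece₂.ρ_pos _ (s₂ t ht))
        (h.piece₃.ρ_pos _ ht₃))
  simp only [X₀, hs, hr] at hshock
  -- the initial data
  have hinit : ∀ᶠ x in 𝓝[≥] (0 : ℝ), (x, (0 : ℝ)) ∈ wedgeBar τ X fun _ => δ := by
    filter_upwards [Ico_mem_nhdsGE hδ] with x hx
    exact ⟨m₀, X₀.le.trans hx.1, hx.2.le⟩
  have iρ : initialSlope W₃ State.ρ = Lρ₃ (1, 0) :=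
    (j₃.ρ_deriv.comp_initial_line hinit).derivWithin huniq
  have iu : initialSlope W₃ State.u = Lu₃ (1, 0) :=
    (j₃.u_deriv.comp_initial_line hinit).derivWithin huniq
  have ip : initialSlope W₃ G.pt = Lp₃ (1, 0) :=
    (j₃.p_deriv.comp_initial_line hinit).derivWithin huniq
  refine ⟨hH, hΦ, hσ', Lu₂ (s.u, 1), Lp₂ (s.u, 1), ?_, ?_, ?_⟩
  · rw [nhdsWithin_union]
    rw [hv₁, eu, ← hv₂] at tu₁
    rw [hs] at tu₂
    exact tu₁.sup tu₂
  · rw [nhdsWithin_union]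
    rw [hv₁, ep, ← hv₂] at tp₁
    rw [hs] at tp₂
    exact tp₁.sup tp₂
  · rw [iρ, iu, ip]
    exact j₂.linear_relation j₃ hs hr hρs hes hρr hσ' hshock

theorem tendsto_vertical_axis {τ : ℝ} {y ξ X : ℝ → ℝ} (hτ : 0 < τ)
    (h : ∀ᶠ t in 𝓝[>] (0 : ℝ), y t < 0 ∧ 0 < X t ∧ ξ t ≠ 0) :
    Tendsto (fun t : ℝ => ((0 : ℝ), t)) (𝓝[>] 0)
      (𝓝[wedge τ y ξ ∪ wedge τ ξ X] ((0 : ℝ), (0 : ℝ))) := by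
  refine tendsto_nhdsWithin_iff.2
    ⟨tendsto_const_nhds.prodMk_nhds (tendsto_id.mono_left nhdsWithin_le_nhds), ?_⟩
  filter_upwards [h, Ioo_mem_nhdsGT hτ] with t ⟨hy, hX, hξ⟩ ht
  rcases lt_or_gt_of_ne hξ with h0 | h0
  · exact Or.inr ⟨ht, h0, hX⟩
  · exact Or.inl ⟨ht, hy, h0⟩

end RadHydro

theorem mainTheorem6 (G : RadHydro.Gas) :
    -- closed forms of the partial derivatives of `e_tot(ρ, p)`
    (∀ ρ p : ℝ, 0 < ρ → 0 < p →
      HasDerivAt (fun r => G.eTotOf r p) (G.eTotDρ ρ p) ρ ∧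
      HasDerivAt (fun q => G.eTotOf ρ q) (G.eTotDp ρ p) p) ∧
    -- the implicit density function `H` and its partial derivatives
    (∀ p pb ρb : ℝ, 0 < p → 0 < pb → 0 < ρb →
      (∀ ρ : ℝ, (0 < ρ ∧ G.Hugoniot p pb ρb ρ) ↔ ρ = G.H p pb ρb) ∧
      HasDerivAt (fun q => G.H q pb ρb) (G.H₁ p pb ρb (G.H p pb ρb)) p ∧
      HasDerivAt (fun q => G.H p q ρb) (G.H₂ p pb ρb (G.H p pb ρb)) pb ∧
      HasDerivAt (fun r => G.H p pb r) (G.H₃ p pb ρb (G.H p pb ρb)) ρb) ∧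
    -- the partial derivatives of `Φ`
    (∀ p pb ρb ρ : ℝ, 0 < ρb → 0 < ρ → 0 < (p - pb) * (1 / ρb - 1 / ρ) →
      HasDerivAt (fun q => RadHydro.Φ q pb ρb ρ) (RadHydro.ΦDp p pb ρb ρ) p ∧
      HasDerivAt (fun q => RadHydro.Φ p q ρb ρ) (RadHydro.ΦDpb p pb ρb ρ) pb ∧
      HasDerivAt (fun r => RadHydro.Φ p pb r ρ) (RadHydro.ΦDρb p pb ρb ρ) ρb ∧
      HasDerivAt (fun r => RadHydro.Φ p pb ρb r) (RadHydro.ΦDρ p pb ρb ρ) ρ) ∧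
    -- the linear relation
    (∀ (UR UR' : ℝ × ℝ × ℝ) (τ δ : ℝ) (y ξ X : ℝ → ℝ)
      (W W₁ W₂ W₃ : ℝ × ℝ → RadHydro.State),
      RadHydro.IsLocalGRPSolution G UR UR' τ δ y ξ X W W₁ W₂ W₃ →
      let s := W₂ (0, 0)
      let r := W₃ (0, 0)
      s.ρ = G.H (G.pt s) (G.pt r) r.ρ ∧
      s.u = r.u + RadHydro.Φ (G.pt s) (G.pt r) r.ρ s.ρ ∧
      derivWithin X (Ico 0 τ) 0 = RadHydro.shockSpeed s r ∧
      ∃ Du Dp : ℝ,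
        Tendsto (RadHydro.matDeriv W RadHydro.State.u)
          (𝓝[RadHydro.wedge τ y ξ ∪ RadHydro.wedge τ ξ X] (0, 0)) (𝓝 Du) ∧
        Tendsto (RadHydro.matDeriv W G.pt)
          (𝓝[RadHydro.wedge τ y ξ ∪ RadHydro.wedge τ ξ X] (0, 0)) (𝓝 Dp) ∧
        ((∀ᶠ t in 𝓝[>] (0 : ℝ), y t < 0 ∧ 0 < X t ∧ ξ t ≠ 0) →
          Tendsto (fun t => RadHydro.matDeriv W RadHydro.State.u (0, t)) (𝓝[>] 0) (𝓝 Du) ∧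
          Tendsto (fun t => RadHydro.matDeriv W G.pt (0, t)) (𝓝[>] 0) (𝓝 Dp)) ∧
        G.coeffA s r * Du + G.coeffB s r * Dp =
          G.coeffD s r (RadHydro.initialSlope W₃ G.pt)
            (RadHydro.initialSlope W₃ RadHydro.State.u)
            (RadHydro.initialSlope W₃ RadHydro.State.ρ)) := by
  refine ⟨fun ρ p hρ hp => ⟨G.hasDerivAt_eTotOf_left hρ hp, G.hasDerivAt_eTotOf_right hρ hp⟩,
    fun p pb ρb hp hpb hρb => ⟨G.hugoniot_iff_eq_H hp hpb hρb, G.hasDerivAt_H_fst hp hpb hρb,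
      G.hasDerivAt_H_snd hp hpb hρb, G.hasDerivAt_H_trd hp hpb hρb⟩,
    fun p pb ρb ρ hρb hρ h => RadHydro.Φ_partials hρb hρ h, ?_⟩
  intro UR UR' τ δ y ξ X W W₁ W₂ W₃ h
  obtain ⟨h1, h2, h3, Du, Dp, hu, hp, hrel⟩ := h.linear_relation rfl rfl
  exact ⟨h1, h2, h3, Du, Dp, hu, hp, fun hax =>
    ⟨hu.comp (RadHydro.tendsto_vertical_axis h.τ_pos hax),
      hp.comp (RadHydro.tendsto_vertical_axis h.τ_pos hax)⟩, hrel⟩
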